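/- **Setting (scalar online LASSO with noisy predictions).** Fix integers $T\ge 1$ (horizon), $w\ge 0$ and reals $\beta>0$, $\sigma>0$. Let $f:\mathbb Z\to\mathbb R$ satisfy $f(0)=1$ and $f(t)=0$ for $t<0$. Let $\hat y_1,\dots,\hat y_T\in\mathbb R$ be arbitrary initial predictions, and let $e(1),\dots,e(T)$ be i.i.d. real random variables with mean $0$, variance $\sigma^2$ and $|e(s)|\le\varepsilon$ almost surely. The targets and their predictions made at time $\tau$ are $$y_t=\hat y_t+\sum_{s=1}^t f(t-s)e(s),\qquad y_{t|\tau}=\hat y_t+\sum_{s=1}^{\tau} f(t-s)e(s)\quad(\tau<t),$$ with $y_{t|\tau}=\hat y_t$ for $\tau\le 0$. With $x_t=0$ for $t\le 0$, the cost of actions $x_1,\dots,x_T\in\mathbb R$ is $\mathrm{cost}(x)=\sum_{t=1}^T\tfrac12(y_t-x_t)^2+\beta|x_t-x_{t-1}|$; $x^*$ denotes its minimiser and $\mathrm{cost}(OPT)$ its minimum. For $k=0,\dots,w$ let $\Omega_k=\{\tau\in\mathbb Z: -w\le\tau\le T,\ \tau\equiv k \bmod (w+1)\}$. The $k$-th fixed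 horizon control algorithm chooses, at each $\tau\in\Omega_k$, actions $x^{(k)}_t$ for the slots $t\in\{\tau,\dots,\tau+w\}\cap\{1,\dots,T\}$ minimising $\sum_t \tfrac12(y_{t|\tau-1}-x_t)^2+\beta|x_t-x_{t-1}|$ over these slots, given the preceding action $x^{(k)}$ (which is $0$ at times $\le 0$). AFHC plays $x_t=\frac1{w+1}\sum_{k=0}^w x^{(k)}_t$. Put $$g_1=\frac1{w+1}\sum_{k=0}^w\sum_{\tau\in\Omega_k}\beta\,|x^*_{\tau-1}-x^{(k)}_{\tau-1}|,\qquad g_2=\frac1{w+1}\sum_{k=0}^w\sum_{\tau\in\Omega_k}\ \sum_{\substack{\tau\le t\le\tau+w\\ 1\le t\le T}}\tfrac12\,(y_t-y_{t|\tau-1})^2,$$ $$\|f_w\|^2=\sigma^2\sum_{s=0}^w f(s)^2,\quad F(w)=\sigma^2\sum_{s=0}^w(w-s+1)f(s)^2,\quad V_1=\frac{3\beta^2T+\beta T\|f_w\|}{w+1},\quad V_2=\frac{T\,F(w)}{2(w+1)},\quad V_T=V_1+V_2 .$$ Let $A_k$ be the $T\times T$ matrix whose $(t,s)$ entry is $f(t-s)$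 if $\tau\le s\le t\le\tau+w$ for some $\tau\in\Omega_k$ and $0$ otherwise, let $A$ be the matrix obtained by stacking $A_0,\dots,A_w$ and dividing by $\sqrt{w+1}$, so that $A^TA=\frac1{w+1}\sum_{k=0}^wA_k^TA_k$, and let $\lambda$ be the largest eigenvalue of $AA^T$. **Theorem.** For every realisation of $e$, $$\mathrm{cost}(AFHC)-\mathrm{cost}(OPT)\le g_1+g_2,\qquad g_2=\tfrac12\|Ae\|^2,$$ and $\lambda\le F(w)/\sigma^2$. The random variables $g_1$, $g_2$ and $\mathrm{cost}(AFHC)-\mathrm{cost}(OPT)$ are integrable, with means at most $V_1$, $V_2$ and $V_T$ respectively. For every $u>0$, $$\mathbb P(g_1>V_1+u)\le\exp\left(\frac{-u^2}{2\varepsilon^2\frac{\beta^2T}{(w+1)\sigma^2}\|f_w\|^2}\right),\qquad \mathbb P(g_2>V_2+u)\le\exp\left(\frac{-u^2}{8\varepsilon^2\lambda\left(\frac{T}{w+1}F(w)+u\right)}\right),$$ $$\mathbb P\big(\mathrm{cost}(AFHC)-\mathrm{cost}(OPT)>V_T+u\big)\le\exp\left(\frac{-u^2}{8\varepsilon^2\frac{\beta^2T}{(w+1)\sigma^2}\|f_w\|^2}\right)+\exp\left(\frac{-u^2}{16\varepsilon^2\lambda\left(\frac{2T}{w+1}F(w)+u\right)}\right)\le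 2\exp\left(\frac{-u^2}{a+bu}\right),$$ where $a=\frac{8\varepsilon^2T}{w+1}\max\left(\frac{\beta^2\|f_w\|^2}{\sigma^2},\,4\lambda F(w)\right)$ and $b=16\varepsilon^2\lambda$. -/

import Mathlib

open MeasureTheory ProbabilityTheory

namespace OnlineLasso

/-! Time slots are integers. The cost-bearing slots are `1, …, T`. A noise path is `e : ℤ → ℝ`, of
which only `e 1, …, e T` are used, and an action sequence is `x : ℤ → ℝ` with `x t = 0` for
`t ≤ 0`. -/

/-- `y_{t|τ} = ŷ_t + ∑_{s=1}^{τ} f(t-s) e(s)`, the prediction of `y_t` made at time `τ`.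
For `τ ≤ 0` the sum is empty and this is the initial prediction `ŷ_t`. -/
noncomputable def prediction (f yhat e : ℤ → ℝ) (τ t : ℤ) : ℝ :=
  yhat t + ∑ s ∈ Finset.Icc 1 τ, f (t - s) * e s

/-- `y_t = ŷ_t + ∑_{s=1}^{t} f(t-s) e(s)`, the realised target. -/
noncomputable def target (f yhat e : ℤ → ℝ) (t : ℤ) : ℝ :=
  yhat t + ∑ s ∈ Finset.Icc 1 t, f (t - s) * e s

/-- `∑_{t=a}^{b} ½ (z_t - x_t)² + β |x_t - x_{t-1}|`. -/
noncomputable def windowCost (β : ℝ) (z : ℤ → ℝ) (a b : ℤ) (x : ℤ → ℝ) : ℝ :=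
  ∑ t ∈ Finset.Icc a b, ((1 / 2) * (z t - x t) ^ 2 + β * |x t - x (t - 1)|)

/-- The total cost over the horizon `1, …, T`. -/
noncomputable def cost (β : ℝ) (T : ℕ) (y x : ℤ → ℝ) : ℝ := windowCost β y 1 T x

/-- `x_a, …, x_b` minimise the cost of the window `[a, b]` with targets `z`, given `x_{a-1}`. -/
def SolvesWindow (β : ℝ) (z : ℤ → ℝ) (a b : ℤ) (x : ℤ → ℝ) : Prop :=
  ∀ v : ℤ → ℝ, v (a - 1) = x (a - 1) → windowCost β z a b x ≤ windowCost β z a b v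

/-- `x` is an optimal dynamic offline solution. -/
def IsOpt (β : ℝ) (T : ℕ) (y x : ℤ → ℝ) : Prop :=
  (∀ t ≤ 0, x t = 0) ∧ SolvesWindow β y 1 T x

/-- `Ω_k = {τ : τ ≡ k mod (w+1)} ∩ [-w, T]`. -/
noncomputable def startTimes (w T k : ℕ) : Finset ℤ :=
  (Finset.Icc (-(w : ℤ)) (T : ℤ)).filter (fun τ => τ ≡ (k : ℤ) [ZMOD ((w : ℤ) + 1)])

/-- The slots of `{1, …, T}` covered by the window `τ, …, τ + w`. -/
noncomputable def windowSlots (w T : ℕ) (τ : ℤ) : Finset ℤ := Finset.Icc (max τ 1) (min (τ + w) T)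

/-- `x` is an action sequence of the `k`-th fixed horizon control algorithm: at every `τ ∈ Ω_k` it
solves the window `τ, …, τ + w` with the predictions made at time `τ - 1`, starting from
`x_{τ-1}`. Actions at times `t ≤ 0` are `0`, and slots after `T` carry no cost. -/
def IsFHC (β : ℝ) (w T k : ℕ) (f yhat e x : ℤ → ℝ) : Prop :=
  (∀ t ≤ 0, x t = 0) ∧
    ∀ τ ∈ startTimes w T k,
      SolvesWindow β (prediction f yhat e (τ - 1)) (max τ 1) (min (τ + w) T) x

theorem windowCost_congr (β : ℝ) (z : ℤ → ℝ) (a b : ℤ) (x v : ℤ → ℝ)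
    (h : ∀ t, a - 1 ≤ t → t ≤ b → x t = v t) :
    windowCost β z a b x = windowCost β z a b v := by
  unfold windowCost
  refine Finset.sum_congr rfl fun t ht => ?_
  rw [Finset.mem_Icc] at ht
  rw [h t (by omega) ht.2, h (t - 1) (by omega) (by omega)]

theorem exists_window_min (β : ℝ) (hβ : 0 ≤ β) (z : ℤ → ℝ) (a b : ℤ) (x : ℤ → ℝ) :
    ∃ v : ℤ → ℝ, (∀ t, t ∉ Finset.Icc a b → v t = x t) ∧ SolvesWindow β z a b v := by
  classical
  let ext : (Finset.Icc a b → ℝ) → ℤ → ℝ :=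
    fun u t => if h : t ∈ Finset.Icc a b then u ⟨t, h⟩ else x t
  have hext : ∀ t, Continuous fun u => ext u t := by
    intro t
    by_cases h : t ∈ Finset.Icc a b
    · simp only [ext, dif_pos h]
      exact continuous_apply _
    · simp only [ext, dif_neg h]
      exact continuous_const
  have hc : Continuous fun u => windowCost β z a b (ext u) := by
    unfold windowCost
    refine continuous_finsetSum _ fun t _ => ?_
    have h1 := hext t
    have h2 := hext (t - 1)
    fun_prop
  let u0 : Finset.Icc a b → ℝ := fun t => z t
  have hterm : ∀ (v : ℤ → ℝ) (t : ℤ),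
      0 ≤ (1 / 2) * (z t - v t) ^ 2 + β * |v t - v (t - 1)| := by
    intro v t
    have := mul_nonneg hβ (abs_nonneg (v t - v (t - 1)))
    have := sq_nonneg (z t - v t)
    linarith
  have hlow : ∀ (v : ℤ → ℝ), ∀ t ∈ Finset.Icc a b,
      (1 / 2) * (z t - v t) ^ 2 ≤ windowCost β z a b v := by
    intro v t ht
    have h1 := Finset.single_le_sum (f := fun t => (1 / 2) * (z t - v t) ^ 2
      + β * |v t - v (t - 1)|) (fun i _ => hterm v i) ht
    have h2 := mul_nonneg hβ (abs_nonneg (v t - v (t - 1)))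
    unfold windowCost
    linarith
  let C := windowCost β z a b (ext u0)
  have hC : 0 ≤ C := Finset.sum_nonneg fun i _ => hterm _ i
  let B : Set (Finset.Icc a b → ℝ) :=
    Set.pi Set.univ fun t => Set.Icc (z t - (2 * C + 1)) (z t + (2 * C + 1))
  have hB : IsCompact B := isCompact_univ_pi fun t => isCompact_Icc
  have hu0 : u0 ∈ B := by
    intro t _
    simp only [u0, Set.mem_Icc]
    constructor <;> linarith
  obtain ⟨u, huB, hu⟩ := hB.exists_isMinOn ⟨u0, hu0⟩ hc.continuousOn
  refine ⟨ext u, fun t ht => by simp only [ext, dif_neg ht], ?_⟩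
  intro v hv
  let v' : Finset.Icc a b → ℝ := fun t => v t
  have hvv : windowCost β z a b v = windowCost β z a b (ext v') := by
    refine windowCost_congr _ _ _ _ _ _ fun t h1 h2 => ?_
    by_cases h : t ∈ Finset.Icc a b
    · simp only [ext, dif_pos h, v']
    · have hta : t = a - 1 := by
        rw [Finset.mem_Icc] at h
        omega
      subst hta
      rw [hv]
      simp [ext]
  rw [hvv]
  by_cases hB' : v' ∈ B
  · exact hu hB'
  · have h1 : windowCost β z a b (ext u) ≤ C := hu hu0
    refine h1.trans ?_
    simp only [B, Set.mem_pi, not_forall] at hB'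
    obtain ⟨t, _, ht⟩ := hB'
    have h2 := hlow (ext v') t t.2
    have h3 : ext v' t = v' t := by simp only [ext, dif_pos t.2]
    rw [h3] at h2
    refine le_trans ?_ h2
    rw [Set.mem_Icc, not_and_or, not_le, not_le] at ht
    rcases ht with ht | ht <;> nlinarith

theorem exists_isOpt (β : ℝ) (hβ : 0 ≤ β) (T : ℕ) (y : ℤ → ℝ) : ∃ x, IsOpt β T y x := by
  obtain ⟨v, h1, h2⟩ := exists_window_min β hβ y 1 T (fun _ => 0)
  exact ⟨v, fun t ht => h1 t (by rw [Finset.mem_Icc]; omega), h2⟩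

theorem exists_isFHC (β : ℝ) (hβ : 0 ≤ β) (w T k : ℕ) (f yhat e : ℤ → ℝ) :
    ∃ x, IsFHC β w T k f yhat e x := by
  have key : ∀ n : ℕ, ∃ x : ℤ → ℝ, (∀ t ≤ 0, x t = 0) ∧
      ∀ τ ∈ startTimes w T k, τ < -(w : ℤ) + n →
        SolvesWindow β (prediction f yhat e (τ - 1)) (max τ 1) (min (τ + w) T) x := by
    intro n
    induction n with
    | zero =>
      refine ⟨fun _ => 0, fun _ _ => rfl, fun τ hτ h => ?_⟩
      simp only [startTimes, Finset.mem_filter, Finset.mem_Icc] at hτ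
      push_cast at h
      omega
    | succ n ih =>
      obtain ⟨x, hx0, hx⟩ := ih
      set m : ℤ := -(w : ℤ) + n with hm
      by_cases hmem : m ∈ startTimes w T k
      · obtain ⟨v, h1, h2⟩ := exists_window_min β hβ (prediction f yhat e (m - 1))
          (max m 1) (min (m + w) T) x
        refine ⟨v, fun t ht => ?_, fun τ hτ h => ?_⟩
        · rw [h1 t (by rw [Finset.mem_Icc]; omega), hx0 t ht]
        · push_cast at h
          rcases eq_or_ne τ m with rfl | hne
          · exact h2
          have hlt : τ < m := by omega
          have hle : τ + w < m := by
            simp only [startTimes, Finset.mem_filter] at hτ hmem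
            have hmod : τ ≡ m [ZMOD ((w : ℤ) + 1)] := hτ.2.trans hmem.2.symm
            have hdvd := hmod.dvd
            have := Int.le_of_dvd (by omega) hdvd
            omega
          have hagree : ∀ t, t ≤ min (τ + w) T ∨ t = max τ 1 - 1 → v t = x t := by
            intro t ht
            exact h1 t (by rw [Finset.mem_Icc]; omega)
          intro u hu
          rw [windowCost_congr _ _ _ _ v x fun t _ h4 => hagree t (Or.inl h4)]
          exact hx τ hτ hlt u (by rw [hu, hagree _ (Or.inr rfl)])
      · refine ⟨x, hx0, fun τ hτ h => hx τ hτ ?_⟩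
        push_cast at h
        have : τ ≠ m := fun h' => hmem (h' ▸ hτ)
        omega
  obtain ⟨x, h0, h⟩ := key (w + T + 1)
  refine ⟨x, h0, fun τ hτ => h τ hτ ?_⟩
  simp only [startTimes, Finset.mem_filter, Finset.mem_Icc] at hτ
  push_cast
  omega

/-- The optimal dynamic offline solution `x*` (the cost is strictly convex, so it is unique on
`1, …, T`). -/
noncomputable def opt (β : ℝ) (T : ℕ) (y : ℤ → ℝ) : ℤ → ℝ :=
  Classical.epsilon (IsOpt β T y)

/-- The action sequence of the `k`-th fixed horizon control algorithm (unique on `1, …, T`). -/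
noncomputable def fhc (β : ℝ) (w T : ℕ) (f yhat e : ℤ → ℝ) (k : ℕ) : ℤ → ℝ :=
  Classical.epsilon (IsFHC β w T k f yhat e)

theorem isOpt_opt (β : ℝ) (hβ : 0 ≤ β) (T : ℕ) (y : ℤ → ℝ) : IsOpt β T y (opt β T y) :=
  Classical.epsilon_spec (exists_isOpt β hβ T y)

theorem isFHC_fhc (β : ℝ) (hβ : 0 ≤ β) (w T k : ℕ) (f yhat e : ℤ → ℝ) :
    IsFHC β w T k f yhat e (fhc β w T f yhat e k) :=
  Classical.epsilon_spec (exists_isFHC β hβ w T k f yhat e)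

/-- Averaging fixed horizon control: the average of the `w + 1` fixed horizon algorithms. -/
noncomputable def afhc (β : ℝ) (w T : ℕ) (f yhat e : ℤ → ℝ) (t : ℤ) : ℝ :=
  (1 / ((w : ℝ) + 1)) * ∑ k ∈ Finset.range (w + 1), fhc β w T f yhat e k t

/-- `cost(AFHC) - cost(OPT)` on the noise path `e`. -/
noncomputable def competitiveDifference (β : ℝ) (w T : ℕ) (f yhat e : ℤ → ℝ) : ℝ :=
  cost β T (target f yhat e) (afhc β w T f yhat e) -
    cost β T (target f yhat e) (opt β T (target f yhat e))

/-- `g₁ = 1/(w+1) ∑_k ∑_{τ ∈ Ω_k} β |x*_{τ-1} - x^{(k)}_{τ-1}|`. -/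
noncomputable def g1 (β : ℝ) (w T : ℕ) (f yhat e : ℤ → ℝ) : ℝ :=
  (1 / ((w : ℝ) + 1)) * ∑ k ∈ Finset.range (w + 1), ∑ τ ∈ startTimes w T k,
    β * |opt β T (target f yhat e) (τ - 1) - fhc β w T f yhat e k (τ - 1)|

/-- `g₂ = 1/(w+1) ∑_k ∑_{τ ∈ Ω_k} ∑_{t=τ}^{τ+w} ½ (y_t - y_{t|τ-1})²`, over slots in `1, …, T`. -/
noncomputable def g2 (w T : ℕ) (f yhat e : ℤ → ℝ) : ℝ :=
  (1 / ((w : ℝ) + 1)) * ∑ k ∈ Finset.range (w + 1), ∑ τ ∈ startTimes w T k,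
    ∑ t ∈ windowSlots w T τ, (1 / 2) * (target f yhat e t - prediction f yhat e (τ - 1) t) ^ 2

/-- The index set `{1, …, T}`. -/
abbrev Slot (T : ℕ) : Type := ↥(Finset.Icc (1 : ℤ) (T : ℤ))

/-- The block diagonal matrix `A_k`: inside each window of `Ω_k` it is the lower triangular
Toeplitz matrix with entries `f(t - s)`. -/
noncomputable def blockMatrix (w T : ℕ) (f : ℤ → ℝ) (k : ℕ) : Matrix (Slot T) (Slot T) ℝ :=
  Matrix.of fun t s =>
    if ∃ τ ∈ startTimes w T k, τ ≤ (s : ℤ) ∧ (s : ℤ) ≤ t ∧ (t : ℤ) ≤ τ + w then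
      f ((t : ℤ) - s) else 0

/-- A matrix `A` with `Aᵀ A = 1/(w+1) ∑_k A_kᵀ A_k`: the `A_k`, scaled and stacked. -/
noncomputable def stackedMatrix (w T : ℕ) (f : ℤ → ℝ) :
    Matrix (Fin (w + 1) × Slot T) (Slot T) ℝ :=
  Matrix.of fun p s => blockMatrix w T f p.1 p.2 s / Real.sqrt ((w : ℝ) + 1)

theorem stackedMatrix_transpose_mul (w T : ℕ) (f : ℤ → ℝ) :
    (stackedMatrix w T f).transpose * stackedMatrix w T f =
      (1 / ((w : ℝ) + 1)) • ∑ k ∈ Finset.range (w + 1),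
        (blockMatrix w T f k).transpose * blockMatrix w T f k := by
  ext i j
  have hs : Real.sqrt ((w : ℝ) + 1) * Real.sqrt ((w : ℝ) + 1) = (w : ℝ) + 1 :=
    Real.mul_self_sqrt (by positivity)
  simp only [Matrix.mul_apply, Matrix.transpose_apply, stackedMatrix, Matrix.of_apply,
    Fintype.sum_prod_type, Matrix.smul_apply, Matrix.sum_apply, smul_eq_mul,
    div_mul_div_comm, hs]
  rw [Finset.sum_range (fun k => ∑ x, blockMatrix w T f k x i * blockMatrix w T f k x j),
    Finset.mul_sum]
  refine Finset.sum_congr rfl fun k _ => ?_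
  rw [Finset.mul_sum]
  refine Finset.sum_congr rfl fun t _ => ?_
  ring

/-- `λ`, the largest eigenvalue of `A Aᵀ`. -/
noncomputable def topEigenvalue (w T : ℕ) (f : ℤ → ℝ) : ℝ :=
  sSup (spectrum ℝ (stackedMatrix w T f * (stackedMatrix w T f).transpose))

/-- `‖f_w‖² = σ² ∑_{s=0}^{w} f(s)²`. -/
noncomputable def fNormSq (σ : ℝ) (f : ℤ → ℝ) (w : ℕ) : ℝ :=
  σ ^ 2 * ∑ s ∈ Finset.range (w + 1), f s ^ 2

/-- `F(w) = σ² ∑_{s=0}^{w} (w - s + 1) f(s)²`. -/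
noncomputable def bigF (σ : ℝ) (f : ℤ → ℝ) (w : ℕ) : ℝ :=
  σ ^ 2 * ∑ s ∈ Finset.range (w + 1), ((w : ℝ) - s + 1) * f s ^ 2

/-- `V₁ = (3 β² + β ‖f_w‖) T / (w+1)`. -/
noncomputable def V1 (β σ : ℝ) (f : ℤ → ℝ) (w T : ℕ) : ℝ :=
  3 * β ^ 2 * T / ((w : ℝ) + 1) + β * T / ((w : ℝ) + 1) * Real.sqrt (fNormSq σ f w)

/-- `V₂ = T F(w) / (2 (w+1))`. -/
noncomputable def V2 (σ : ℝ) (f : ℤ → ℝ) (w T : ℕ) : ℝ :=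
  T / (2 * ((w : ℝ) + 1)) * bigF σ f w

end OnlineLasso

/-! The cost is 1-strongly convex in the actions, so a window minimiser `x` beats any competitor `v`
with the same preceding action by at least `½‖x - v‖²`. If the window was solved for predictions `z`
instead of the targets `y`, the resulting cross term `∑ (y - z)(v - x)` is at most `½‖y - z‖² + ½‖x
- v‖²`. The growth term pays for the second half, and correcting the preceding action costs `β`
times its error. Summing over the windows of `Ω_k` with `v = x*` and averaging over `k` (Jensen)
gives `g1 + g2` (`competitiveDifference_le`).

For `g1`: moving one action of a minimiser onto its target changes at most two switching terms, and
only one at the last slot of a window. So at time `τ - 1` the offline optimum is within `2β` of the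
target and the algorithm within `β` of its prediction. Hence `g1` is at most `3β²T/(w+1)` plus a
multiple of a sum of absolute prediction errors. Second moments bound the mean of that sum, and
McDiarmid's inequality its upper tail.

For `g2 = ½‖Ae‖²` the differences are not bounded tightly enough, and the entropy method is used.
Entropy is subadditive over independent coordinates. For one centred coordinate bounded by `ε` it is
at most `2ε²` times the mean of (gradient)² times the exponential. Since the gradient of `½‖Ae‖²`
has squared norm `‖AᵀAe‖² ≤ λ‖Ae‖²`, the form bounds its own entropy, and Herbst's argument gives a
Bernstein-type tail.

The actions are chosen by `Classical.epsilon`, so their measurability is not automatic. Minimisers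
depend continuously on targets and preceding action, so every quantity is a continuous function of
the noise. Replacing the noise by its clamped copy in `[-ε, ε]^T` then makes all integrability
conditions consequences of compactness. -/

namespace OnlineLasso

/-! ### Convexity, growth and stability of a window problem. -/

/-- Strong convexity of the window cost along a segment. -/
theorem windowCost_segment_le {β : ℝ} (hβ : 0 ≤ β) (z : ℤ → ℝ) (a b : ℤ) (x v : ℤ → ℝ) {θ : ℝ}
    (h0 : 0 ≤ θ) (h1 : θ ≤ 1) :
    windowCost β z a b (fun t => (1 - θ) * x t + θ * v t) ≤
      (1 - θ) * windowCost β z a b x + θ * windowCost β z a b v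
        - θ * (1 - θ) * ((1 / 2) * ∑ t ∈ Finset.Icc a b, (x t - v t) ^ 2) := by
  unfold windowCost
  simp only [Finset.mul_sum]
  rw [← Finset.sum_add_distrib, ← Finset.sum_sub_distrib]
  refine Finset.sum_le_sum fun t _ => ?_
  have h2 : |(1 - θ) * x t + θ * v t - ((1 - θ) * x (t - 1) + θ * v (t - 1))| ≤
      (1 - θ) * |x t - x (t - 1)| + θ * |v t - v (t - 1)| := by
    calc _ = |(1 - θ) * (x t - x (t - 1)) + θ * (v t - v (t - 1))| := by ring_nf
      _ ≤ |(1 - θ) * (x t - x (t - 1))| + |θ * (v t - v (t - 1))| := abs_add_le _ _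
      _ = _ := by rw [abs_mul, abs_mul, abs_of_nonneg h0, abs_of_nonneg (by linarith : 0 ≤ 1 - θ)]
  have h3 := mul_le_mul_of_nonneg_left h2 hβ
  nlinarith [h3]

/-- Quadratic growth of the window cost at a minimiser. -/
theorem SolvesWindow.add_sq_le {β : ℝ} (hβ : 0 ≤ β) {z : ℤ → ℝ} {a b : ℤ} {x : ℤ → ℝ}
    (hx : SolvesWindow β z a b x) (v : ℤ → ℝ) (hv : v (a - 1) = x (a - 1)) :
    windowCost β z a b x + (1 / 2) * ∑ t ∈ Finset.Icc a b, (x t - v t) ^ 2 ≤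
      windowCost β z a b v := by
  set S := (1 / 2) * ∑ t ∈ Finset.Icc a b, (x t - v t) ^ 2
  refine le_of_forall_pos_le_add fun δ hδ => ?_
  have hS : 0 ≤ S := mul_nonneg (by norm_num) (Finset.sum_nonneg fun t _ => sq_nonneg _)
  -- Minimality along the segment to `v` yields the growth term with a factor `1 - θ`. Choosing `θ *
  -- S ≤ δ` stands in for the limit `θ → 0`.
  obtain ⟨θ, h0, h1, h2⟩ : ∃ θ : ℝ, 0 < θ ∧ θ ≤ 1 ∧ θ * S ≤ δ := by
    refine ⟨min 1 (δ / (S + 1)), by positivity, min_le_left _ _, ?_⟩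
    calc min 1 (δ / (S + 1)) * S ≤ δ / (S + 1) * S := by gcongr; exact min_le_right _ _
      _ ≤ δ / (S + 1) * (S + 1) := by gcongr; linarith
      _ = δ := by field_simp
  have h3 := hx (fun t => (1 - θ) * x t + θ * v t) (by simp only [hv]; ring)
  have h4 : _ ≤ (1 - θ) * windowCost β z a b x + θ * windowCost β z a b v - θ * (1 - θ) * S :=
    windowCost_segment_le hβ z a b x v h0.le h1
  have h5 : θ * (windowCost β z a b x + S) ≤ θ * (windowCost β z a b v + δ) := by
    nlinarith [mul_le_mul_of_nonneg_left h2 h0.le]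
  exact le_of_mul_le_mul_left h5 h0

/-- A minimiser stays close to each target: within `β`, plus another `β` if the slot is followed by
a further slot of the window. -/
theorem SolvesWindow.abs_sub_le {β : ℝ} (hβ : 0 ≤ β) {z : ℤ → ℝ} {a b : ℤ} {x : ℤ → ℝ}
    (hx : SolvesWindow β z a b x) {t : ℤ} (ht : t ∈ Finset.Icc a b) :
    |z t - x t| ≤ β + if t + 1 ∈ Finset.Icc a b then β else 0 := by
  classical
  have ht' := Finset.mem_Icc.1 ht
  -- Moving slot `t` onto its target saves the quadratic term and disturbs only the switching terms
  -- at `t` and `t + 1`. Quadratic growth contributes a second half square, which is why the bound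
  -- is `β` per switching term and not `2β`.
  set v := Function.update x t (z t) with hv
  have h1 := hx.add_sq_le hβ v (by rw [hv, Function.update_of_ne (by omega)])
  have h2 : (x t - v t) ^ 2 ≤ ∑ t ∈ Finset.Icc a b, (x t - v t) ^ 2 :=
    Finset.single_le_sum (f := fun t => (x t - v t) ^ 2) (fun i _ => sq_nonneg _) ht
  have h3 : windowCost β z a b v ≤ windowCost β z a b x
      + (∑ i ∈ Finset.Icc a b, if i = t then β * |z t - x t| - (1 / 2) * (z t - x t) ^ 2 else 0)
      + ∑ i ∈ Finset.Icc a b, if i = t + 1 then β * |z t - x t| else 0 := by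
    unfold windowCost
    rw [← Finset.sum_add_distrib, ← Finset.sum_add_distrib]
    refine Finset.sum_le_sum fun i _ => ?_
    rcases eq_or_ne i t with rfl | hi
    · have h4 : |z i - x (i - 1)| ≤ |x i - x (i - 1)| + |z i - x i| := by
        calc _ = |(x i - x (i - 1)) + (z i - x i)| := by ring_nf
          _ ≤ _ := abs_add_le _ _
      have h5 : v (i - 1) = x (i - 1) := Function.update_of_ne (by omega) _ _
      have h6 : v i = z i := Function.update_self _ _ _
      rw [h5, h6]
      simp only [if_true, if_neg (show ¬ i = i + 1 by omega)]
      nlinarith [mul_le_mul_of_nonneg_left h4 hβ]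
    · have h5 : v i = x i := Function.update_of_ne hi _ _
      rw [h5, if_neg hi]
      by_cases hi' : i = t + 1
      · subst hi'
        have h6 : v (t + 1 - 1) = z t := by rw [add_sub_cancel_right]; exact Function.update_self _ _ _
        rw [h6, if_pos rfl, add_sub_cancel_right]
        have h4 : |x (t + 1) - z t| ≤ |x (t + 1) - x t| + |z t - x t| := by
          rw [abs_sub_comm (z t)]
          exact _root_.abs_sub_le _ _ _
        nlinarith [mul_le_mul_of_nonneg_left h4 hβ]
      · have h6 : v (i - 1) = x (i - 1) := Function.update_of_ne (by omega) _ _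
        rw [h6, if_neg hi']
        simp
  rw [Finset.sum_ite_eq' , Finset.sum_ite_eq', if_pos ht] at h3
  have h6 : v t = z t := Function.update_self _ _ _
  rw [h6] at h2
  have h7 : (z t - x t) ^ 2 = |z t - x t| ^ 2 := (sq_abs _).symm
  have h8 : |z t - x t| ^ 2 ≤ |z t - x t| * (β + if t + 1 ∈ Finset.Icc a b then β else 0) := by
    split_ifs at h3 ⊢ <;> nlinarith
  rcases (abs_nonneg (z t - x t)).eq_or_lt with h0 | h0
  · rw [← h0]
    split_ifs <;> linarith
  · rw [sq] at h8
    exact le_of_mul_le_mul_left h8 h0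

/-- Replacing the action that precedes the window. -/
theorem windowCost_update_le {β : ℝ} (hβ : 0 ≤ β) (z : ℤ → ℝ) (a b : ℤ) (x : ℤ → ℝ) (p : ℝ) :
    windowCost β z a b (Function.update x (a - 1) p) ≤
      windowCost β z a b x + β * |x (a - 1) - p| := by
  classical
  have h : windowCost β z a b (Function.update x (a - 1) p) ≤ windowCost β z a b x
      + ∑ i ∈ Finset.Icc a b, if i = a then β * |x (a - 1) - p| else 0 := by
    unfold windowCost
    rw [← Finset.sum_add_distrib]
    refine Finset.sum_le_sum fun i hi => ?_
    have hi' := Finset.mem_Icc.1 hi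
    have h5 : Function.update x (a - 1) p i = x i := Function.update_of_ne (by omega) _ _
    rw [h5]
    by_cases h : i = a
    · subst h
      rw [Function.update_self, if_pos rfl]
      have := _root_.abs_sub_le (x i) (x (i - 1)) p
      nlinarith [mul_le_mul_of_nonneg_left this hβ]
    · rw [Function.update_of_ne (by omega), if_neg h]
      simp
  refine h.trans ?_
  rw [Finset.sum_ite_eq']
  have := mul_nonneg hβ (abs_nonneg (x (a - 1) - p))
  split_ifs <;> linarith

/-- The competitor's preceding action is first corrected to that of `x`. This costs one switching
term and leaves the sum of squares alone, because slot `a - 1` lies outside the window. -/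
theorem SolvesWindow.add_sq_le_update {β : ℝ} (hβ : 0 ≤ β) {z : ℤ → ℝ} {a b : ℤ} {x : ℤ → ℝ}
    (hx : SolvesWindow β z a b x) (v : ℤ → ℝ) :
    windowCost β z a b x + (1 / 2) * ∑ t ∈ Finset.Icc a b, (x t - v t) ^ 2 ≤
      windowCost β z a b v + β * |v (a - 1) - x (a - 1)| := by
  refine le_trans (le_of_eq ?_) ((hx.add_sq_le hβ _ (Function.update_self _ _ _)).trans
    (windowCost_update_le hβ z a b v (x (a - 1))))
  congr 2
  refine Finset.sum_congr rfl fun t ht => ?_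
  rw [Finset.mem_Icc] at ht
  rw [Function.update_of_ne (by omega)]

/-- Switching terms and the squares of the targets cancel in a cost difference, so a change of
targets enters only through a bilinear term. -/
theorem windowCost_sub_windowCost (β : ℝ) (y z : ℤ → ℝ) (a b : ℤ) (x v : ℤ → ℝ) :
    windowCost β y a b x - windowCost β y a b v =
      windowCost β z a b x - windowCost β z a b v
        + ∑ t ∈ Finset.Icc a b, (y t - z t) * (v t - x t) := by
  unfold windowCost
  rw [← Finset.sum_sub_distrib, ← Finset.sum_sub_distrib, ← Finset.sum_add_distrib]
  refine Finset.sum_congr rfl fun t _ => ?_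
  ring

/-- Solving a window with wrong targets and a wrong initial action. -/
theorem SolvesWindow.windowCost_le {β : ℝ} (hβ : 0 ≤ β) {z : ℤ → ℝ} {a b : ℤ} {x : ℤ → ℝ}
    (hx : SolvesWindow β z a b x) (y v : ℤ → ℝ) :
    windowCost β y a b x ≤ windowCost β y a b v + β * |v (a - 1) - x (a - 1)|
      + ∑ t ∈ Finset.Icc a b, (1 / 2) * (y t - z t) ^ 2 := by
  have h1 := windowCost_sub_windowCost β y z a b x v
  have h2 := hx.add_sq_le_update hβ v
  rw [Finset.mul_sum] at h2
  -- Young's inequality with weights `½, ½`: the second half is exactly the growth term of `h2`.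
  have h3 : ∑ t ∈ Finset.Icc a b, (y t - z t) * (v t - x t) ≤
      ∑ t ∈ Finset.Icc a b, (1 / 2) * (y t - z t) ^ 2
        + ∑ t ∈ Finset.Icc a b, (1 / 2) * (x t - v t) ^ 2 := by
    rw [← Finset.sum_add_distrib]
    refine Finset.sum_le_sum fun t _ => ?_
    nlinarith [sq_nonneg ((y t - z t) - (v t - x t))]
  linarith

/-- Stability of minimisers in the targets and the initial action. -/
theorem SolvesWindow.sum_sq_sub_le {β : ℝ} (hβ : 0 ≤ β) {z z' : ℤ → ℝ} {a b : ℤ} {x x' : ℤ → ℝ}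
    (hx : SolvesWindow β z a b x) (hx' : SolvesWindow β z' a b x') :
    ∑ t ∈ Finset.Icc a b, (x t - x' t) ^ 2 ≤
      ∑ t ∈ Finset.Icc a b, (z t - z' t) ^ 2 + 4 * β * |x (a - 1) - x' (a - 1)| := by
  have h1 := windowCost_sub_windowCost β z z' a b x x'
  have h2 := hx.add_sq_le_update hβ x'
  have h3 := hx'.add_sq_le_update hβ x
  rw [abs_sub_comm] at h2
  have h4 : ∑ t ∈ Finset.Icc a b, (x' t - x t) ^ 2 = ∑ t ∈ Finset.Icc a b, (x t - x' t) ^ 2 :=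
    Finset.sum_congr rfl fun t _ => by ring
  -- The two growth inequalities together supply a full `∑ (x - x')²`; Young's inequality consumes
  -- only half of it.
  have h5 : -∑ t ∈ Finset.Icc a b, (z t - z' t) * (x' t - x t) ≤
      (1 / 2) * ∑ t ∈ Finset.Icc a b, (z t - z' t) ^ 2
        + (1 / 2) * ∑ t ∈ Finset.Icc a b, (x t - x' t) ^ 2 := by
    rw [← Finset.sum_neg_distrib, Finset.mul_sum, Finset.mul_sum, ← Finset.sum_add_distrib]
    refine Finset.sum_le_sum fun t _ => ?_
    nlinarith [sq_nonneg ((z t - z' t) + (x' t - x t))]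
  linarith

theorem windowCost_sum_le {ι : Type*} (s : Finset ι) (c : ι → ℝ) (hc : ∀ i ∈ s, 0 ≤ c i)
    (hc1 : ∑ i ∈ s, c i = 1) {β : ℝ} (hβ : 0 ≤ β) (z : ℤ → ℝ) (a b : ℤ) (x : ι → ℤ → ℝ) :
    windowCost β z a b (fun t => ∑ i ∈ s, c i * x i t) ≤
      ∑ i ∈ s, c i * windowCost β z a b (x i) := by
  unfold windowCost
  simp only [Finset.mul_sum]
  rw [Finset.sum_comm]
  refine Finset.sum_le_sum fun t _ => ?_
  have h1 : (z t - ∑ i ∈ s, c i * x i t) ^ 2 ≤ ∑ i ∈ s, c i * (z t - x i t) ^ 2 := by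
    have := (even_two.convexOn_pow (𝕜 := ℝ)).map_sum_le (t := s) (w := c)
      (p := fun i => z t - x i t) hc hc1 (by simp)
    simp only [smul_eq_mul] at this
    refine le_trans (le_of_eq ?_) this
    congr 1
    simp only [mul_sub, Finset.sum_sub_distrib, ← Finset.sum_mul, hc1, one_mul]
  have h2 : |∑ i ∈ s, c i * x i t - ∑ i ∈ s, c i * x i (t - 1)| ≤
      ∑ i ∈ s, c i * |x i t - x i (t - 1)| := by
    rw [← Finset.sum_sub_distrib]
    refine (Finset.abs_sum_le_sum_abs _ _).trans (Finset.sum_le_sum fun i hi => ?_)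
    rw [← mul_sub, abs_mul, abs_of_nonneg (hc i hi)]
  calc _ ≤ 1 / 2 * ∑ i ∈ s, c i * (z t - x i t) ^ 2
        + β * ∑ i ∈ s, c i * |x i t - x i (t - 1)| := by gcongr
    _ = _ := by
      rw [Finset.mul_sum, Finset.mul_sum, ← Finset.sum_add_distrib]
      refine Finset.sum_congr rfl fun i _ => ?_
      ring

/-! ### Combinatorics of the windows. -/

theorem mem_startTimes {w T k : ℕ} {τ : ℤ} :
    τ ∈ startTimes w T k ↔ (-(w : ℤ) ≤ τ ∧ τ ≤ T) ∧ τ ≡ (k : ℤ) [ZMOD ((w : ℤ) + 1)] := by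
  simp [startTimes]

theorem mem_windowSlots {w T : ℕ} {τ t : ℤ} :
    t ∈ windowSlots w T τ ↔ (1 ≤ t ∧ t ≤ T) ∧ τ ≤ t ∧ t ≤ τ + w := by
  simp only [windowSlots, Finset.mem_Icc]
  omega

theorem exists_startTime (w T k : ℕ) {t : ℤ} (h1 : 1 ≤ t) (hT : t ≤ T) :
    ∃ τ ∈ startTimes w T k, τ ≤ t ∧ t ≤ τ + w := by
  have hw : (0 : ℤ) < (w : ℤ) + 1 := by positivity
  have h2 := Int.emod_nonneg (t - k) hw.ne'
  have h3 := Int.emod_lt_of_pos (t - k) hw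
  -- The largest integer up to `t` in the class of `k`; it is at least `t - w`, and `t ≥ 1` keeps it
  -- above `-w`.
  refine ⟨t - (t - k) % ((w : ℤ) + 1), mem_startTimes.2 ⟨⟨by omega, by omega⟩, ?_⟩,
    by omega, by omega⟩
  rw [Int.modEq_comm, Int.modEq_iff_dvd]
  refine ⟨(t - k) / ((w : ℤ) + 1), ?_⟩
  have := Int.emod_add_mul_ediv (t - k) ((w : ℤ) + 1)
  linarith

/-- Distinct elements of `Ω_k` differ by at least `w + 1`, while both starts would lie in `[t - w,
t]`. -/
theorem startTime_unique {w T k : ℕ} {τ τ' t : ℤ} (hτ : τ ∈ startTimes w T k)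
    (hτ' : τ' ∈ startTimes w T k) (h : τ ≤ t ∧ t ≤ τ + w) (h' : τ' ≤ t ∧ t ≤ τ' + w) :
    τ = τ' := by
  have hmod := (mem_startTimes.1 hτ).2.trans (mem_startTimes.1 hτ').2.symm
  rcases lt_trichotomy τ τ' with hlt | heq | hlt
  · have := Int.le_of_dvd (by omega) hmod.dvd
    omega
  · exact heq
  · have := Int.le_of_dvd (by omega) hmod.symm.dvd
    omega

/-- The windows of `Ω_k` partition the horizon. -/
theorem sum_startTimes_sum_windowSlots (w T k : ℕ) (h : ℤ → ℝ) :
    ∑ τ ∈ startTimes w T k, ∑ t ∈ windowSlots w T τ, h t = ∑ t ∈ Finset.Icc (1 : ℤ) T, h t := by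
  classical
  rw [← Finset.sum_biUnion]
  · refine Finset.sum_congr ?_ fun _ _ => rfl
    ext t
    simp only [Finset.mem_biUnion, mem_windowSlots, Finset.mem_Icc]
    constructor
    · rintro ⟨τ, -, h, -⟩
      exact h
    · rintro h
      obtain ⟨τ, h1, h2⟩ := exists_startTime w T k h.1 h.2
      exact ⟨τ, h1, h, h2⟩
  · intro τ hτ τ' hτ' hne
    rw [Function.onFun, Finset.disjoint_left]
    intro t ht ht'
    exact hne (startTime_unique hτ hτ' (mem_windowSlots.1 ht).2 (mem_windowSlots.1 ht').2)

/-- The sets `Ω_0, …, Ω_w` partition `{-w, …, T}`. -/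
theorem sum_range_sum_startTimes (w T : ℕ) (h : ℤ → ℝ) :
    ∑ k ∈ Finset.range (w + 1), ∑ τ ∈ startTimes w T k, h τ =
      ∑ τ ∈ Finset.Icc (-(w : ℤ)) T, h τ := by
  classical
  have hw : (0 : ℤ) < (w : ℤ) + 1 := by positivity
  rw [← Finset.sum_fiberwise_of_maps_to (s := Finset.Icc (-(w : ℤ)) T)
    (t := Finset.range (w + 1)) (g := fun τ => (τ % ((w : ℤ) + 1)).toNat)]
  · refine Finset.sum_congr rfl fun k hk => Finset.sum_congr ?_ fun _ _ => rfl
    rw [Finset.mem_range] at hk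
    refine Finset.filter_congr fun τ _ => ?_
    have h2 := Int.emod_nonneg τ hw.ne'
    rw [Int.ModEq, Int.emod_eq_of_lt (a := (k : ℤ)) (by omega) (by omega)]
    omega
  · intro τ _
    have h2 := Int.emod_nonneg τ hw.ne'
    have h3 := Int.emod_lt_of_pos τ hw
    rw [Finset.mem_range]
    omega

/-- The lag `t - s` maps the interval injectively into `{0, …, i}`. Only an inequality is asked, so
that blocks truncated by the horizon are covered. -/
theorem sum_Icc_comp_sub_left_le {g : ℤ → ℝ} (hg : ∀ t, 0 ≤ g t) {a t : ℤ} {i : ℕ}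
    (h : t - a ≤ i) : ∑ s ∈ Finset.Icc a t, g (t - s) ≤ ∑ j ∈ Finset.range (i + 1), g j := by
  classical
  calc ∑ s ∈ Finset.Icc a t, g (t - s)
      = ∑ s ∈ Finset.Icc a t, g (((t - s).toNat : ℕ) : ℤ) :=
        Finset.sum_congr rfl fun s hs => by
          rw [Finset.mem_Icc] at hs
          rw [Int.toNat_of_nonneg (by omega)]
    _ = ∑ j ∈ (Finset.Icc a t).image fun s => (t - s).toNat, g j := by
        rw [Finset.sum_image]
        intro s hs s' hs' hss
        simp only [Finset.coe_Icc, Set.mem_Icc] at hs hs' hss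
        omega
    _ ≤ _ := by
        refine Finset.sum_le_sum_of_subset_of_nonneg ?_ fun j _ _ => hg j
        intro j hj
        simp only [Finset.mem_image, Finset.mem_Icc, Finset.mem_range] at hj ⊢
        omega

theorem sum_Icc_comp_sub_right_le {g : ℤ → ℝ} (hg : ∀ t, 0 ≤ g t) {a b : ℤ} {i : ℕ}
    (h : b - a ≤ i) : ∑ t ∈ Finset.Icc a b, g (t - a) ≤ ∑ j ∈ Finset.range (i + 1), g j := by
  refine le_trans (le_of_eq ?_) (sum_Icc_comp_sub_left_le hg h)
  refine Finset.sum_nbij' (fun t => a + b - t) (fun t => a + b - t) ?_ ?_ ?_ ?_ ?_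
  · intro t ht; rw [Finset.mem_Icc] at ht ⊢; omega
  · intro t ht; rw [Finset.mem_Icc] at ht ⊢; omega
  · intro t _; ring
  · intro t _; ring
  · intro t _; congr 1; ring

/-- Summation by rows and by diagonals of a lower triangular Toeplitz array. -/
theorem sum_range_triangle (g : ℕ → ℝ) (w : ℕ) :
    ∑ i ∈ Finset.range (w + 1), ∑ j ∈ Finset.range (i + 1), g j =
      ∑ j ∈ Finset.range (w + 1), ((w : ℝ) - j + 1) * g j := by
  induction w with
  | zero => simp
  | succ w ih =>
    rw [Finset.sum_range_succ, ih, Finset.sum_range_succ _ (w + 1),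
      Finset.sum_range_succ (fun j => (((w + 1 : ℕ) : ℝ) - j + 1) * g j), ← add_assoc,
      ← Finset.sum_add_distrib]
    congr 1
    · refine Finset.sum_congr rfl fun j _ => ?_
      push_cast
      ring
    · simp

/-! ### The deterministic regret bound and the quadratic form of the second penalty. -/

theorem target_sub_prediction (f yhat e : ℤ → ℝ) {τ t : ℤ} (h : τ ≤ t) :
    target f yhat e t - prediction f yhat e (τ - 1) t =
      ∑ s ∈ Finset.Icc (max τ 1) t, f (t - s) * e s := by
  classical
  unfold target prediction
  rw [add_sub_add_left_eq_sub, sub_eq_iff_eq_add, ← Finset.sum_union]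
  · refine Finset.sum_congr ?_ fun _ _ => rfl
    ext s
    simp only [Finset.mem_union, Finset.mem_Icc]
    omega
  · rw [Finset.disjoint_left]
    intro s
    simp only [Finset.mem_Icc]
    omega

theorem cost_fhc_le {β : ℝ} (hβ : 0 ≤ β) {w T k : ℕ} {f yhat e x : ℤ → ℝ}
    (hx : IsFHC β w T k f yhat e x) (y v : ℤ → ℝ) (hv : ∀ t ≤ 0, v t = 0) :
    cost β T y x ≤ cost β T y v + ∑ τ ∈ startTimes w T k, β * |v (τ - 1) - x (τ - 1)|
      + ∑ τ ∈ startTimes w T k, ∑ t ∈ windowSlots w T τ,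
          (1 / 2) * (y t - prediction f yhat e (τ - 1) t) ^ 2 := by
  have hc : ∀ u, cost β T y u = ∑ τ ∈ startTimes w T k,
      windowCost β y (max τ 1) (min (τ + w) T) u := fun u =>
    (sum_startTimes_sum_windowSlots w T k _).symm
  rw [hc, hc, ← Finset.sum_add_distrib, ← Finset.sum_add_distrib]
  refine Finset.sum_le_sum fun τ hτ => ?_
  refine ((hx.2 τ hτ).windowCost_le hβ y v).trans ?_
  -- A window starting at or before slot 1 is truncated to begin at slot 1; both preceding actions
  -- are then `0` and the penalty vanishes.
  have h1 : |v (max τ 1 - 1) - x (max τ 1 - 1)| ≤ |v (τ - 1) - x (τ - 1)| := by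
    rcases le_total τ 1 with h | h
    · rw [max_eq_right h, hv _ (by norm_num), hx.1 _ (by norm_num)]
      simp
    · rw [max_eq_left h]
  have h2 := mul_le_mul_of_nonneg_left h1 hβ
  simp only [windowSlots]
  linarith

theorem competitiveDifference_le {β : ℝ} (hβ : 0 ≤ β) (w T : ℕ) (f yhat e : ℤ → ℝ) :
    competitiveDifference β w T f yhat e ≤ g1 β w T f yhat e + g2 w T f yhat e := by
  set y := target f yhat e with hy
  have hopt := isOpt_opt β hβ T y
  have hw : (0 : ℝ) < (w : ℝ) + 1 := by positivity
  have h1 : cost β T y (afhc β w T f yhat e) ≤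
      ∑ k ∈ Finset.range (w + 1), (1 / ((w : ℝ) + 1)) * cost β T y (fhc β w T f yhat e k) := by
    have := windowCost_sum_le (Finset.range (w + 1)) (fun _ => 1 / ((w : ℝ) + 1))
      (fun _ _ => by positivity) (by simp [hw.ne']) hβ y 1 T (fhc β w T f yhat e)
    refine le_trans (le_of_eq ?_) this
    unfold cost
    congr 1
    ext t
    rw [afhc, Finset.mul_sum]
  have h2 : ∑ k ∈ Finset.range (w + 1), (1 / ((w : ℝ) + 1)) * cost β T y (fhc β w T f yhat e k) ≤
      ∑ k ∈ Finset.range (w + 1), (1 / ((w : ℝ) + 1)) * (cost β T y (opt β T y)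
        + ∑ τ ∈ startTimes w T k, β * |opt β T y (τ - 1) - fhc β w T f yhat e k (τ - 1)|
        + ∑ τ ∈ startTimes w T k, ∑ t ∈ windowSlots w T τ,
          (1 / 2) * (y t - prediction f yhat e (τ - 1) t) ^ 2) :=
    Finset.sum_le_sum fun k _ => mul_le_mul_of_nonneg_left
      (cost_fhc_le hβ (isFHC_fhc β hβ w T k f yhat e) y _ hopt.1) (by positivity)
  simp only [mul_add, Finset.sum_add_distrib, ← Finset.mul_sum] at h1 h2
  rw [Finset.sum_const, Finset.card_range, nsmul_eq_mul] at h2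
  push_cast at h2
  rw [← mul_assoc, one_div_mul_cancel hw.ne', one_mul] at h2
  rw [competitiveDifference, g1, g2, ← hy]
  simp only [← Finset.mul_sum]
  linarith

/-- Row `t` meets a single window of `Ω_k`, so the existential in the entries reduces to the given
`τ`. -/
theorem blockMatrix_mulVec_apply {w T k : ℕ} (f v : ℤ → ℝ) {τ : ℤ} (hτ : τ ∈ startTimes w T k)
    (t : Slot T) (ht : (t : ℤ) ∈ windowSlots w T τ) :
    (blockMatrix w T f k).mulVec (fun s => v s) t =
      ∑ s ∈ Finset.Icc (max τ 1) (t : ℤ), f (t - s) * v s := by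
  rw [mem_windowSlots] at ht
  have h1 : ∀ s : Slot T, blockMatrix w T f k t s =
      if τ ≤ (s : ℤ) ∧ (s : ℤ) ≤ t then f ((t : ℤ) - s) else 0 := by
    intro s
    simp only [blockMatrix, Matrix.of_apply]
    refine if_congr ⟨?_, fun h => ⟨τ, hτ, h.1, h.2, ht.2.2⟩⟩ rfl rfl
    rintro ⟨τ', hτ', h1, h2, h3⟩
    rw [startTime_unique hτ hτ' ht.2 ⟨h1.trans h2, h3⟩]
    exact ⟨h1, h2⟩
  simp only [Matrix.mulVec, dotProduct, h1, ite_mul, zero_mul]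
  rw [Finset.sum_coe_sort (Finset.Icc (1 : ℤ) T)
    (fun s => if τ ≤ s ∧ s ≤ (t : ℤ) then f ((t : ℤ) - s) * v s else 0), ← Finset.sum_filter]
  refine Finset.sum_congr ?_ fun _ _ => rfl
  ext s
  simp only [Finset.mem_filter, Finset.mem_Icc]
  omega

theorem sum_blockMatrix_mulVec_sq (w T k : ℕ) (f v : ℤ → ℝ) :
    ∑ t, ((blockMatrix w T f k).mulVec (fun s => v s) t) ^ 2 =
      ∑ τ ∈ startTimes w T k, ∑ t ∈ windowSlots w T τ,
        (∑ s ∈ Finset.Icc (max τ 1) t, f (t - s) * v s) ^ 2 := by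
  classical
  set h : ℤ → ℝ := fun t => if ht : t ∈ Finset.Icc (1 : ℤ) T then
    ((blockMatrix w T f k).mulVec (fun s => v s) ⟨t, ht⟩) ^ 2 else 0 with hh
  have h1 : ∑ t, ((blockMatrix w T f k).mulVec (fun s => v s) t) ^ 2 =
      ∑ t ∈ Finset.Icc (1 : ℤ) T, h t := by
    rw [← Finset.sum_coe_sort (Finset.Icc (1 : ℤ) T) h]
    refine Finset.sum_congr rfl fun t _ => ?_
    simp only [hh, dif_pos t.2]
  rw [h1, ← sum_startTimes_sum_windowSlots w T k]
  refine Finset.sum_congr rfl fun τ hτ => Finset.sum_congr rfl fun t ht => ?_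
  have ht' : t ∈ Finset.Icc (1 : ℤ) T := Finset.mem_Icc.2 (mem_windowSlots.1 ht).1
  simp only [hh, dif_pos ht']
  rw [blockMatrix_mulVec_apply f v hτ ⟨t, ht'⟩ ht]

theorem sum_stackedMatrix_mulVec_sq (w T : ℕ) (f v : ℤ → ℝ) :
    ∑ i, ((stackedMatrix w T f).mulVec (fun s => v s) i) ^ 2 =
      (1 / ((w : ℝ) + 1)) * ∑ k ∈ Finset.range (w + 1), ∑ τ ∈ startTimes w T k,
        ∑ t ∈ windowSlots w T τ, (∑ s ∈ Finset.Icc (max τ 1) t, f (t - s) * v s) ^ 2 := by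
  simp only [← sum_blockMatrix_mulVec_sq]
  rw [Finset.sum_range (fun k => ∑ t, ((blockMatrix w T f k).mulVec (fun s => v s) t) ^ 2),
    Fintype.sum_prod_type, Finset.mul_sum]
  refine Finset.sum_congr rfl fun k _ => ?_
  rw [Finset.mul_sum]
  refine Finset.sum_congr rfl fun t _ => ?_
  have h1 : (stackedMatrix w T f).mulVec (fun s => v s) (k, t) =
      (blockMatrix w T f k).mulVec (fun s => v s) t / Real.sqrt ((w : ℝ) + 1) := by
    simp only [Matrix.mulVec, dotProduct, stackedMatrix, Matrix.of_apply, Finset.sum_div]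
    exact Finset.sum_congr rfl fun s _ => by ring
  rw [h1, div_pow, Real.sq_sqrt (by positivity)]
  ring

theorem g2_eq (w T : ℕ) (f yhat e : ℤ → ℝ) :
    g2 w T f yhat e = (1 / 2) * ∑ i, ((stackedMatrix w T f).mulVec (fun s => e s) i) ^ 2 := by
  rw [sum_stackedMatrix_mulVec_sq, g2, mul_left_comm]
  congr 1
  simp only [Finset.mul_sum]
  refine Finset.sum_congr rfl fun k _ => Finset.sum_congr rfl fun τ _ =>
    Finset.sum_congr rfl fun t ht => ?_
  rw [target_sub_prediction f yhat e (mem_windowSlots.1 ht).2.1]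

/-! ### The largest eigenvalue of `A Aᵀ`. -/

/-- The squared Frobenius norm of a full block of `A_k`, which is `F(w) / σ²`. -/
noncomputable def blockNormSq (f : ℤ → ℝ) (w : ℕ) : ℝ :=
  ∑ s ∈ Finset.range (w + 1), ((w : ℝ) - s + 1) * f s ^ 2

theorem bigF_eq (σ : ℝ) (f : ℤ → ℝ) (w : ℕ) : bigF σ f w = σ ^ 2 * blockNormSq f w := rfl

theorem blockNormSq_nonneg (f : ℤ → ℝ) (w : ℕ) : 0 ≤ blockNormSq f w := by
  rw [blockNormSq, ← sum_range_triangle (fun j => f j ^ 2)]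
  exact Finset.sum_nonneg fun _ _ => Finset.sum_nonneg fun _ _ => sq_nonneg _

/-- Row number `i` of a block holds the lags `0, …, i`; a truncated block is dominated by the full
one. -/
theorem sum_window_sq_le (f : ℤ → ℝ) {w : ℕ} {a b : ℤ} (h : b - a ≤ w) :
    ∑ t ∈ Finset.Icc a b, ∑ s ∈ Finset.Icc a t, f (t - s) ^ 2 ≤ blockNormSq f w := by
  set q : ℤ → ℝ := fun i => ∑ j ∈ Finset.range (i.toNat + 1), f j ^ 2 with hq
  have hq0 : ∀ i, 0 ≤ q i := fun i => Finset.sum_nonneg fun _ _ => sq_nonneg _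
  calc ∑ t ∈ Finset.Icc a b, ∑ s ∈ Finset.Icc a t, f (t - s) ^ 2
      ≤ ∑ t ∈ Finset.Icc a b, q (t - a) := by
        refine Finset.sum_le_sum fun t ht => ?_
        rw [Finset.mem_Icc] at ht
        exact sum_Icc_comp_sub_left_le (g := fun i => f i ^ 2) (i := (t - a).toNat)
          (fun _ => sq_nonneg _) (by omega)
    _ ≤ ∑ i ∈ Finset.range (w + 1), q i :=
        sum_Icc_comp_sub_right_le (g := q) hq0 h
    _ = blockNormSq f w := by
        rw [blockNormSq, ← sum_range_triangle (fun j => f j ^ 2)]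
        simp only [hq, Int.toNat_natCast]

/-- Cauchy–Schwarz in each row bounds the operator norm of a block by its Frobenius norm. Blocks of
one `A_k` act on disjoint slots, and the average over `k` preserves the bound. -/
theorem sum_stackedMatrix_mulVec_sq_le (w T : ℕ) (f : ℤ → ℝ) (u : Slot T → ℝ) :
    ∑ i, ((stackedMatrix w T f).mulVec u i) ^ 2 ≤ blockNormSq f w * ∑ s, u s ^ 2 := by
  classical
  set v : ℤ → ℝ := fun t => if h : t ∈ Finset.Icc (1 : ℤ) T then u ⟨t, h⟩ else 0 with hv
  have huv : u = fun s : Slot T => v s := by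
    ext s
    simp only [hv, dif_pos s.2]
  have hsum : ∑ s, u s ^ 2 = ∑ s ∈ Finset.Icc (1 : ℤ) T, v s ^ 2 := by
    rw [huv]
    exact Finset.sum_coe_sort (Finset.Icc (1 : ℤ) T) (fun s => v s ^ 2)
  rw [hsum, huv, sum_stackedMatrix_mulVec_sq]
  have h1 : ∀ k ∈ Finset.range (w + 1), ∑ τ ∈ startTimes w T k, ∑ t ∈ windowSlots w T τ,
      (∑ s ∈ Finset.Icc (max τ 1) t, f (t - s) * v s) ^ 2 ≤
      blockNormSq f w * ∑ s ∈ Finset.Icc (1 : ℤ) T, v s ^ 2 := by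
    intro k _
    rw [← sum_startTimes_sum_windowSlots w T k, Finset.mul_sum]
    refine Finset.sum_le_sum fun τ _ => ?_
    calc ∑ t ∈ windowSlots w T τ, (∑ s ∈ Finset.Icc (max τ 1) t, f (t - s) * v s) ^ 2
        ≤ ∑ t ∈ windowSlots w T τ, (∑ s ∈ Finset.Icc (max τ 1) t, f (t - s) ^ 2)
            * ∑ s ∈ windowSlots w T τ, v s ^ 2 := by
          refine Finset.sum_le_sum fun t ht => ?_
          refine (Finset.sum_mul_sq_le_sq_mul_sq _ _ _).trans ?_
          refine mul_le_mul_of_nonneg_left ?_ (Finset.sum_nonneg fun _ _ => sq_nonneg _)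
          refine Finset.sum_le_sum_of_subset_of_nonneg ?_ fun _ _ _ => sq_nonneg _
          intro s hs
          rw [mem_windowSlots] at ht ⊢
          rw [Finset.mem_Icc] at hs
          omega
      _ ≤ _ := by
          rw [← Finset.sum_mul]
          refine mul_le_mul_of_nonneg_right ?_ (Finset.sum_nonneg fun _ _ => sq_nonneg _)
          exact sum_window_sq_le f (by omega)
  have h2 := Finset.sum_le_sum h1
  rw [Finset.sum_const, Finset.card_range, nsmul_eq_mul] at h2
  push_cast at h2
  rw [one_div, inv_mul_le_iff₀ (by positivity)]
  exact h2

open Matrix in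
theorem dotProduct_mulVec_transpose_self {m n : Type*} [Fintype m] [Fintype n]
    (A : Matrix m n ℝ) (v : m → ℝ) :
    v ⬝ᵥ (A * Aᵀ) *ᵥ v = ∑ j, (Aᵀ *ᵥ v) j ^ 2 := by
  rw [← Matrix.mulVec_mulVec, Matrix.dotProduct_mulVec, ← Matrix.mulVec_transpose]
  simp only [dotProduct, sq]

-- The eigenvalues of `λI - AAᵀ` are `λ` minus spectral values of `AAᵀ`, hence nonnegative, so this
-- matrix is positive semidefinite.
open Matrix in
theorem sum_transpose_mulVec_sq_le {m n : Type*} [Fintype m] [DecidableEq m] [Fintype n]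
    (A : Matrix m n ℝ) (v : m → ℝ) :
    ∑ j, (Aᵀ *ᵥ v) j ^ 2 ≤ sSup (spectrum ℝ (A * Aᵀ)) * ∑ i, v i ^ 2 := by
  set M := A * Aᵀ with hM
  set l := sSup (spectrum ℝ M)
  have hMh : M.IsHermitian := Matrix.isHermitian_mul_conjTranspose_self A
  have hb : BddAbove (spectrum ℝ M) := by
    rw [hMh.spectrum_real_eq_range_eigenvalues]
    exact (Set.finite_range _).bddAbove
  have hH : (algebraMap ℝ (Matrix m m ℝ) l - M).IsHermitian := by
    refine Matrix.IsHermitian.sub ?_ hMh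
    rw [Matrix.algebraMap_eq_diagonal]
    exact Matrix.isHermitian_diagonal _
  have hpsd : (algebraMap ℝ (Matrix m m ℝ) l - M).PosSemidef := by
    rw [hH.posSemidef_iff_eigenvalues_nonneg]
    intro i
    have h1 : hH.eigenvalues i ∈ spectrum ℝ (algebraMap ℝ (Matrix m m ℝ) l - M) := by
      rw [hH.spectrum_real_eq_range_eigenvalues]
      exact ⟨i, rfl⟩
    rw [← spectrum.singleton_sub_eq, Set.singleton_sub] at h1
    obtain ⟨x, hx, hxi⟩ := h1
    have := le_csSup hb hx
    rw [← hxi]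
    exact sub_nonneg.2 this
  have h2 := hpsd.dotProduct_mulVec_nonneg v
  rw [star_trivial, Matrix.sub_mulVec, dotProduct_sub, hM, dotProduct_mulVec_transpose_self,
    Algebra.algebraMap_eq_smul_one, Matrix.smul_mulVec, Matrix.one_mulVec, dotProduct_smul] at h2
  simp only [dotProduct, ← sq, smul_eq_mul] at h2
  linarith

-- On an eigenvector `v` of value `x`, the norm bound applied to `Aᵀv` reads `x²‖v‖² ≤ (blockNormSq)
-- x‖v‖²`; one factor `x` cancels unless `x = 0`.
open Matrix in
theorem topEigenvalue_le (w T : ℕ) (f : ℤ → ℝ) : topEigenvalue w T f ≤ blockNormSq f w := by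
  refine Real.sSup_le (fun x hx => ?_) (blockNormSq_nonneg f w)
  set A := stackedMatrix w T f
  rw [← Matrix.spectrum_toLin', ← Module.End.hasEigenvalue_iff_mem_spectrum] at hx
  obtain ⟨v, hv⟩ := hx.exists_hasEigenvector
  have h1 : (A * Aᵀ) *ᵥ v = x • v := by
    rw [← Matrix.toLin'_apply]
    exact hv.apply_eq_smul
  have h2 := dotProduct_mulVec_transpose_self A v
  have h3 := sum_stackedMatrix_mulVec_sq_le w T f (Aᵀ *ᵥ v)
  rw [Matrix.mulVec_mulVec, ← h2, h1, dotProduct_smul] at h3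
  have h4 : 0 < v ⬝ᵥ v := by
    refine lt_of_le_of_ne (Finset.sum_nonneg fun i _ => mul_self_nonneg _) fun h => hv.2 ?_
    exact dotProduct_self_eq_zero.1 h.symm
  have h5 : ∑ i, (x • v) i ^ 2 = x ^ 2 * (v ⬝ᵥ v) := by
    simp only [Pi.smul_apply, smul_eq_mul, mul_pow, dotProduct, ← sq, ← Finset.mul_sum]
  have h6 : 0 ≤ x * (v ⬝ᵥ v) := by
    have := Finset.sum_nonneg fun j (_ : j ∈ Finset.univ) => sq_nonneg ((Aᵀ *ᵥ v) j)
    rw [← h2, h1, dotProduct_smul] at this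
    exact this
  rw [h5, smul_eq_mul] at h3
  have hx0 : 0 ≤ x := nonneg_of_mul_nonneg_left h6 h4
  rcases hx0.eq_or_lt with h0 | h0
  · rw [← h0]
    exact blockNormSq_nonneg f w
  · have h7 : (x * (v ⬝ᵥ v)) * x ≤ (x * (v ⬝ᵥ v)) * blockNormSq f w := by linarith
    exact le_of_mul_le_mul_left h7 (by positivity)

-- Tested on the basis vector of a diagonal position, where the entry of `A` is `f 0 / √(w+1)` and
-- so not zero.
open Matrix in
theorem topEigenvalue_pos (w : ℕ) {T : ℕ} (hT : 1 ≤ T) {f : ℤ → ℝ} (hf0 : f 0 = 1) :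
    0 < topEigenvalue w T f := by
  classical
  set A := stackedMatrix w T f
  let t : Slot T := ⟨1, by rw [Finset.mem_Icc]; omega⟩
  obtain ⟨τ, hτ, h1, h2⟩ := exists_startTime w T 0 le_rfl (by omega : (1 : ℤ) ≤ T)
  have hA : A ((0 : Fin (w + 1)), t) t = 1 / Real.sqrt ((w : ℝ) + 1) := by
    simp only [A, stackedMatrix, blockMatrix, Matrix.of_apply]
    rw [if_pos ⟨τ, hτ, h1, le_rfl, h2⟩, sub_self, hf0]
  have h3 := sum_transpose_mulVec_sq_le A (Pi.single ((0 : Fin (w + 1)), t) 1)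
  have h4 : ∑ i, (Pi.single ((0 : Fin (w + 1)), t) (1 : ℝ) : Fin (w + 1) × Slot T → ℝ) i ^ 2 = 1 := by
    rw [Finset.sum_eq_single ((0 : Fin (w + 1)), t)] <;> simp +contextual
  rw [h4, mul_one] at h3
  refine lt_of_lt_of_le ?_ h3
  have h5 := Finset.single_le_sum (f := fun j => (Aᵀ *ᵥ Pi.single ((0 : Fin (w + 1)), t) 1) j ^ 2)
    (fun j _ => sq_nonneg _) (Finset.mem_univ t)
  refine lt_of_lt_of_le ?_ h5
  simp only [Matrix.mulVec_single_one, Matrix.col_apply, Matrix.transpose_apply, hA]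
  positivity

/-! ### Entropy and exponential moments on compact spaces. -/

section Compact

variable {α : Type*} [TopologicalSpace α] [CompactSpace α] [MeasurableSpace α] [BorelSpace α]

theorem integrable_of_continuous_compact (μ : Measure α) [IsFiniteMeasure μ] {f : α → ℝ}
    (hf : Continuous f) : Integrable f μ :=
  hf.integrable_of_hasCompactSupport (HasCompactSupport.of_compactSpace f)

theorem integral_exp_pos_of_continuous (μ : Measure α) [IsProbabilityMeasure μ] {f : α → ℝ}
    (hf : Continuous f) : 0 < ∫ a, Real.exp (f a) ∂μ :=
  integral_exp_pos (integrable_of_continuous_compact μ (Real.continuous_exp.comp hf))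

/-- The entropy of `exp y`. -/
noncomputable def expEntropy (μ : Measure α) (y : α → ℝ) : ℝ :=
  ∫ a, y a * Real.exp (y a) ∂μ - (∫ a, Real.exp (y a) ∂μ) * Real.log (∫ a, Real.exp (y a) ∂μ)

/-- Hoeffding's lemma for a function of bounded oscillation. -/
theorem integral_exp_le_of_oscillation (ν : Measure α) [IsProbabilityMeasure ν] {y : α → ℝ}
    (hy : Continuous y) {c : ℝ} (h : ∀ a b, |y a - y b| ≤ c) :
    ∫ a, Real.exp (y a) ∂ν ≤ Real.exp (∫ a, y a ∂ν + c ^ 2 / 8) := by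
  have : Nonempty α := nonempty_of_isProbabilityMeasure ν
  obtain ⟨a₀, -, ha₀⟩ := isCompact_univ.exists_isMinOn Set.univ_nonempty hy.continuousOn
  -- Compactness provides a minimum point, so the range of `y` lies in an interval of length `c`
  -- starting at the minimum; the variance proxy is `c² / 4`.
  have hsub := hasSubgaussianMGF_of_mem_Icc (μ := ν) (a := y a₀) (b := y a₀ + c)
    hy.measurable.aemeasurable (ae_of_all _ fun a => ⟨ha₀ (Set.mem_univ a), by
      have := (abs_le.1 (h a a₀)).2
      linarith⟩)
  have h1 := hsub.mgf_le 1
  have hc : 0 ≤ c := (abs_nonneg _).trans (h a₀ a₀)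
  simp only [mgf, one_mul, Real.exp_sub, integral_div] at h1
  rw [div_le_iff₀ (Real.exp_pos _), ← Real.exp_add] at h1
  refine h1.trans (Real.exp_le_exp.2 (le_of_eq ?_))
  have : (((‖y a₀ + c - y a₀‖₊ / 2) ^ 2 : NNReal) : ℝ) = c ^ 2 / 4 := by
    push_cast
    rw [add_sub_cancel_left, Real.norm_of_nonneg hc]
    ring
  rw [this]
  ring

variable {β : Type*} [TopologicalSpace β] [CompactSpace β] [T2Space β]
  [SecondCountableTopology β] [MeasurableSpace β] [BorelSpace β]

theorem continuous_integral_right {α : Type*} [TopologicalSpace α] [CompactSpace α] [T2Space α]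
    [SecondCountableTopology α] (ν : Measure β) [IsFiniteMeasure ν] {f : α → β → ℝ}
    (hf : Continuous f.uncurry) : Continuous fun a => ∫ b, f a b ∂ν := by
  have := continuous_parametric_integral_of_continuous (μ := ν) hf isCompact_univ
  simpa only [Measure.restrict_univ] using this

variable [SecondCountableTopology α]

/-- Subadditivity of entropy for two factors. -/
theorem expEntropy_prod_le [T2Space α] (μ : Measure α) (ν : Measure β) [IsProbabilityMeasure μ]
    [IsProbabilityMeasure ν] {y p q : α × β → ℝ} (hy : Continuous y) (hp : Continuous p)
    (hq : Continuous q)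
    (h1 : ∀ a, expEntropy ν (fun b => y (a, b)) ≤ ∫ b, p (a, b) ∂ν)
    (h2 : ∀ b, expEntropy μ (fun a => y (a, b)) ≤ ∫ a, q (a, b) ∂μ) :
    expEntropy (μ.prod ν) y ≤ ∫ x, p x ∂(μ.prod ν) + ∫ x, q x ∂(μ.prod ν) := by
  have hi : ∀ {f : α × β → ℝ}, Continuous f → Integrable f (μ.prod ν) :=
    fun hf => integrable_of_continuous_compact _ hf
  have he : Continuous fun x => Real.exp (y x) := Real.continuous_exp.comp hy
  set g : α → ℝ := fun a => ∫ b, Real.exp (y (a, b)) ∂ν with hg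
  set h : β → ℝ := fun b => ∫ a, Real.exp (y (a, b)) ∂μ with hh
  set m : ℝ := ∫ x, Real.exp (y x) ∂(μ.prod ν) with hm
  have hgc : Continuous g := continuous_integral_right ν (f := fun a b => Real.exp (y (a, b))) he
  have hhc : Continuous h := continuous_integral_right μ (f := fun b a => Real.exp (y (a, b)))
    (he.comp continuous_swap)
  have hgp : ∀ a, 0 < g a := fun a => integral_exp_pos_of_continuous ν (hy.comp (by fun_prop))
  have hhp : ∀ b, 0 < h b := fun b => integral_exp_pos_of_continuous μ (hy.comp (by fun_prop))
  have hmp : 0 < m := integral_exp_pos_of_continuous _ hy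
  have hgl : Continuous fun a => Real.log (g a) := hgc.log fun a => (hgp a).ne'
  have hhl : Continuous fun b => Real.log (h b) := hhc.log fun b => (hhp b).ne'
  have hgm : ∫ a, g a ∂μ = m := (integral_prod _ (hi he)).symm
  have hhm : ∫ b, h b ∂ν = m := (integral_prod_symm _ (hi he)).symm
  -- This is `log r ≤ r - 1` at `r = g h / (m exp y)`, times `exp y`. The right side integrates to
  -- zero because `g` and `h` both have mean `m`.
  have key : ∀ x : α × β, Real.exp (y x) * Real.log (g x.1) + Real.exp (y x) * Real.log (h x.2)
      - Real.exp (y x) * Real.log m - y x * Real.exp (y x) ≤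
      g x.1 * h x.2 / m - Real.exp (y x) := by
    intro x
    have hX := Real.exp_pos (y x)
    have h3 := Real.log_le_sub_one_of_pos
      (div_pos (mul_pos (hgp x.1) (hhp x.2)) (mul_pos hmp hX))
    rw [Real.log_div (mul_pos (hgp x.1) (hhp x.2)).ne' (mul_pos hmp hX).ne',
      Real.log_mul (hgp _).ne' (hhp _).ne', Real.log_mul hmp.ne' hX.ne', Real.log_exp] at h3
    have h4 := mul_le_mul_of_nonneg_left h3 hX.le
    have h5 : Real.exp (y x) * (g x.1 * h x.2 / (m * Real.exp (y x)) - 1) =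
        g x.1 * h x.2 / m - Real.exp (y x) := by
      field_simp
    linarith
  have i1 : Integrable (fun x : α × β => Real.exp (y x) * Real.log (g x.1)) (μ.prod ν) :=
    hi (he.mul (hgl.comp continuous_fst))
  have i2 : Integrable (fun x : α × β => Real.exp (y x) * Real.log (h x.2)) (μ.prod ν) :=
    hi (he.mul (hhl.comp continuous_snd))
  have i3 : Integrable (fun x : α × β => Real.exp (y x) * Real.log m) (μ.prod ν) :=
    hi (he.mul continuous_const)
  have i4 : Integrable (fun x : α × β => y x * Real.exp (y x)) (μ.prod ν) := hi (hy.mul he)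
  have i5 : Integrable (fun x : α × β => g x.1 * h x.2 / m) (μ.prod ν) :=
    hi (((hgc.comp continuous_fst).mul (hhc.comp continuous_snd)).div_const _)
  have i12 : Integrable (fun x : α × β => Real.exp (y x) * Real.log (g x.1)
      + Real.exp (y x) * Real.log (h x.2)) (μ.prod ν) := i1.add i2
  have i123 : Integrable (fun x : α × β => Real.exp (y x) * Real.log (g x.1)
      + Real.exp (y x) * Real.log (h x.2) - Real.exp (y x) * Real.log m) (μ.prod ν) := i12.sub i3
  have hint := integral_mono (i123.sub i4) (i5.sub (hi he)) key
  simp only [Pi.sub_apply] at hint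
  rw [integral_sub i123 i4, integral_sub i12 i3, integral_add i1 i2,
    integral_sub i5 (hi he), integral_mul_const, ← hm, integral_div,
    integral_prod_mul (μ := μ) (ν := ν) g h, hgm, hhm, mul_div_assoc, div_self hmp.ne',
    mul_one, sub_self] at hint
  have e1 : ∫ x, Real.exp (y x) * Real.log (g x.1) ∂(μ.prod ν)
      = ∫ a, g a * Real.log (g a) ∂μ := by
    rw [integral_prod _ i1]
    simp only [integral_mul_const, hg]
  have e2 : ∫ x, Real.exp (y x) * Real.log (h x.2) ∂(μ.prod ν)
      = ∫ b, h b * Real.log (h b) ∂ν := by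
    rw [integral_prod_symm _ i2]
    simp only [integral_mul_const, hh]
  have c1 : ∫ x, y x * Real.exp (y x) ∂(μ.prod ν) - ∫ a, g a * Real.log (g a) ∂μ ≤
      ∫ x, p x ∂(μ.prod ν) := by
    have i7 : Integrable (fun a => g a * Real.log (g a)) μ :=
      integrable_of_continuous_compact _ (hgc.mul hgl)
    rw [integral_prod _ i4, integral_prod _ (hi hp), ← integral_sub i4.integral_prod_left i7]
    exact integral_mono (i4.integral_prod_left.sub i7) (hi hp).integral_prod_left h1
  have c2 : ∫ x, y x * Real.exp (y x) ∂(μ.prod ν) - ∫ b, h b * Real.log (h b) ∂ν ≤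
      ∫ x, q x ∂(μ.prod ν) := by
    have i7 : Integrable (fun b => h b * Real.log (h b)) ν :=
      integrable_of_continuous_compact _ (hhc.mul hhl)
    rw [integral_prod_symm _ i4, integral_prod_symm _ (hi hq),
      ← integral_sub i4.integral_prod_right i7]
    exact integral_mono (i4.integral_prod_right.sub i7) (hi hq).integral_prod_right h2
  rw [expEntropy, ← hm]
  linarith

/-- Entropy of one bounded centred coordinate: if `y` has upper slope `d` with respect to `c`. -/
theorem expEntropy_le_integral_sq_mul_exp (ν : Measure α) [IsProbabilityMeasure ν] {c y d : α → ℝ}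
    (hc : Continuous c) (hy : Continuous y) (hd : Continuous d) {ε : ℝ} (hε : ∀ a, |c a| ≤ ε)
    (hc0 : ∫ a, c a ∂ν = 0) (h : ∀ a b, y a - y b ≤ d a * (c a - c b)) :
    expEntropy ν y ≤ ∫ a, 2 * ε ^ 2 * d a ^ 2 * Real.exp (y a) ∂ν := by
  have hi : ∀ {f : α → ℝ}, Continuous f → Integrable f ν :=
    fun hf => integrable_of_continuous_compact _ hf
  have hi2 : ∀ {f : α × α → ℝ}, Continuous f → Integrable f (ν.prod ν) :=
    fun hf => integrable_of_continuous_compact _ hf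
  have he : Continuous fun a => Real.exp (y a) := Real.continuous_exp.comp hy
  have hm := integral_exp_pos_of_continuous ν hy
  -- By Jensen, the entropy is at most the covariance of `y` and `exp y`, which an independent copy
  -- symmetrises below.
  have hj : ∫ a, y a ∂ν ≤ Real.log (∫ a, Real.exp (y a) ∂ν) := by
    rw [Real.le_log_iff_exp_le hm]
    exact convexOn_exp.map_integral_le Real.continuous_exp.continuousOn isClosed_univ
      (by simp) (hi hy) (hi he)
  set m := ∫ a, Real.exp (y a) ∂ν with hmdef
  have h1 : expEntropy ν y ≤ ∫ a, y a * Real.exp (y a) ∂ν - m * ∫ a, y a ∂ν := by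
    have := mul_le_mul_of_nonneg_left hj hm.le
    rw [expEntropy, ← hmdef]
    linarith
  set J : α × α → ℝ := fun x => d x.1 ^ 2 * (c x.1 - c x.2) ^ 2 * Real.exp (y x.1) with hJ
  have hJc : Continuous J := by fun_prop
  -- The left side is `(y a - y b)(exp (y a) - exp (y b))`. Only the slope and exponential at the
  -- point with larger `y` are used, so a one-sided slope bound suffices.
  have hpt : ∀ x : α × α, y x.1 * Real.exp (y x.1) + y x.2 * Real.exp (y x.2)
      - y x.1 * Real.exp (y x.2) - Real.exp (y x.1) * y x.2 ≤ J x + J x.swap := by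
    have aux : ∀ a b, y b ≤ y a → (y a - y b) * (Real.exp (y a) - Real.exp (y b)) ≤ J (a, b) := by
      intro a b hab
      have h2 : Real.exp (y a) - Real.exp (y b) ≤ (y a - y b) * Real.exp (y a) := by
        have := Real.add_one_le_exp (y b - y a)
        have h3 : Real.exp (y b) = Real.exp (y b - y a) * Real.exp (y a) := by
          rw [← Real.exp_add]; ring_nf
        rw [h3]
        nlinarith [Real.exp_pos (y a)]
      have h4 : (y a - y b) ^ 2 ≤ (d a * (c a - c b)) ^ 2 :=
        pow_le_pow_left₀ (by linarith) (h a b) 2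
      calc _ ≤ (y a - y b) * ((y a - y b) * Real.exp (y a)) :=
            mul_le_mul_of_nonneg_left h2 (by linarith)
        _ = (y a - y b) ^ 2 * Real.exp (y a) := by ring
        _ ≤ (d a * (c a - c b)) ^ 2 * Real.exp (y a) := by gcongr
        _ = J (a, b) := by simp only [hJ]; ring
    have hJ0 : ∀ x, 0 ≤ J x := fun x => by positivity
    rintro ⟨a, b⟩
    simp only [Prod.swap_prod_mk]
    rcases le_total (y b) (y a) with hab | hab
    · nlinarith [aux a b hab, hJ0 (b, a)]
    · nlinarith [aux b a hab, hJ0 (a, b)]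
  have i1 : Integrable (fun x : α × α => y x.1 * Real.exp (y x.1)) (ν.prod ν) :=
    hi2 (by fun_prop)
  have i2 : Integrable (fun x : α × α => y x.2 * Real.exp (y x.2)) (ν.prod ν) :=
    hi2 (by fun_prop)
  have i3 : Integrable (fun x : α × α => y x.1 * Real.exp (y x.2)) (ν.prod ν) :=
    hi2 (by fun_prop)
  have i4 : Integrable (fun x : α × α => Real.exp (y x.1) * y x.2) (ν.prod ν) :=
    hi2 (by fun_prop)
  have i6 : Integrable (fun x : α × α => J x.swap) (ν.prod ν) :=
    hi2 (hJc.comp continuous_swap)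
  have i12 : Integrable (fun x : α × α => y x.1 * Real.exp (y x.1) + y x.2 * Real.exp (y x.2))
      (ν.prod ν) := i1.add i2
  have i123 : Integrable (fun x : α × α => y x.1 * Real.exp (y x.1) + y x.2 * Real.exp (y x.2)
      - y x.1 * Real.exp (y x.2)) (ν.prod ν) := i12.sub i3
  have hint := integral_mono (i123.sub i4) ((hi2 hJc).add i6) hpt
  simp only [Pi.add_apply, Pi.sub_apply] at hint
  rw [integral_sub i123 i4, integral_sub i12 i3, integral_add i1 i2,
    integral_add (hi2 hJc) i6, integral_prod_swap (μ := ν) (ν := ν) J,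
    integral_prod_mul (μ := ν) (ν := ν) y (fun a => Real.exp (y a)),
    integral_prod_mul (μ := ν) (ν := ν) (fun a => Real.exp (y a)) y,
    integral_fun_fst (fun a => y a * Real.exp (y a)),
    integral_fun_snd (fun a => y a * Real.exp (y a))] at hint
  simp only [probReal_univ, one_smul] at hint
  have hJe : ∫ x, J x ∂(ν.prod ν) ≤ ∫ a, 2 * ε ^ 2 * d a ^ 2 * Real.exp (y a) ∂ν := by
    rw [integral_prod _ (hi2 hJc)]
    refine integral_mono (hi2 hJc).integral_prod_left (hi (by fun_prop)) fun a => ?_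
    simp only [hJ]
    rw [integral_mul_const, integral_const_mul]
    -- The cross term integrates to zero because `c` is centred.
    have h5 : ∫ b, (c a - c b) ^ 2 ∂ν ≤ 2 * ε ^ 2 := by
      have h6 : ∀ b, (c a - c b) ^ 2 ≤ 2 * ε ^ 2 - 2 * c a * c b := by
        intro b
        have := sq_le_sq' (abs_le.1 (hε a)).1 (abs_le.1 (hε a)).2
        have := sq_le_sq' (abs_le.1 (hε b)).1 (abs_le.1 (hε b)).2
        nlinarith
      have := integral_mono (hi (by fun_prop)) (hi (f := fun b => 2 * ε ^ 2 - 2 * c a * c b)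
        (by fun_prop)) h6
      rw [integral_sub (integrable_const _) (hi (by fun_prop)),
        integral_const_mul (2 * c a), hc0] at this
      simpa using this
    calc _ ≤ d a ^ 2 * (2 * ε ^ 2) * Real.exp (y a) := by gcongr
      _ = _ := by ring
  rw [← hmdef] at hint
  linarith

end Compact

/-! ### Finite products: tensorised entropy and McDiarmid's inequality. -/

section Product

variable {K : Type*} [TopologicalSpace K] [CompactSpace K] [T2Space K]
  [SecondCountableTopology K] [MeasurableSpace K] [BorelSpace K]

theorem integral_pi_succ {K : Type*} [MeasurableSpace K] {n : ℕ} (ν : Fin (n + 1) → Measure K)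
    [∀ i, IsProbabilityMeasure (ν i)] (f : (Fin (n + 1) → K) → ℝ) :
    ∫ x, f x ∂(Measure.pi ν) =
      ∫ p, f (Fin.cons p.1 p.2) ∂((ν 0).prod (Measure.pi fun j => ν j.succ)) := by
  have h := (measurePreserving_piFinSuccAbove ν 0).symm
  rw [← h.integral_comp' f]
  simp only [MeasurableEquiv.piFinSuccAbove_symm_apply, Fin.insertNthEquiv, Equiv.coe_fn_mk,
    Fin.insertNth_zero, Fin.zero_succAbove, cast_eq]

/-- Subadditivity of entropy for finite products. -/
theorem expEntropy_pi_le {n : ℕ} (ν : Fin n → Measure K) [∀ i, IsProbabilityMeasure (ν i)]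
    {y : (Fin n → K) → ℝ} (hy : Continuous y) {B : Fin n → (Fin n → K) → ℝ}
    (hB : ∀ i, Continuous (B i))
    (h : ∀ i x, expEntropy (ν i) (fun r => y (Function.update x i r)) ≤
      ∫ r, B i (Function.update x i r) ∂(ν i)) :
    expEntropy (Measure.pi ν) y ≤ ∑ i, ∫ x, B i x ∂(Measure.pi ν) := by
  induction n with
  | zero =>
    rw [Measure.pi_of_empty ν]
    simp [expEntropy, mul_comm]
  | succ n ih =>
    have hcons : Continuous fun p : K × (Fin n → K) => (Fin.cons p.1 p.2 : Fin (n + 1) → K) :=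
      Continuous.finCons continuous_fst continuous_snd
    have hconsr : ∀ a : K, Continuous fun b : Fin n → K => (Fin.cons a b : Fin (n + 1) → K) :=
      fun a => Continuous.finCons continuous_const continuous_id
    obtain ⟨a₀⟩ : Nonempty K := nonempty_of_isProbabilityMeasure (ν 0)
    have h1 : expEntropy (Measure.pi ν) y = expEntropy
        ((ν 0).prod (Measure.pi fun j => ν j.succ)) (fun p => y (Fin.cons p.1 p.2)) := by
      simp only [expEntropy]
      rw [integral_pi_succ ν (fun x => y x * Real.exp (y x)),
        integral_pi_succ ν (fun x => Real.exp (y x))]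
    have h2 := expEntropy_prod_le (ν 0) (Measure.pi fun j => ν j.succ)
      (y := fun p => y (Fin.cons p.1 p.2))
      (p := fun p => ∑ i : Fin n, B i.succ (Fin.cons p.1 p.2))
      (q := fun p => B 0 (Fin.cons p.1 p.2)) (hy.comp hcons)
      (continuous_finsetSum _ fun i _ => (hB _).comp hcons) ((hB _).comp hcons)
      (fun a => by
        have hs := integral_finsetSum (μ := Measure.pi fun j => ν j.succ) Finset.univ
          (f := fun (i : Fin n) b => B i.succ (Fin.cons a b))
          fun i _ => integrable_of_continuous_compact _ ((hB i.succ).comp (hconsr a))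
        rw [hs]
        refine ih (fun j => ν j.succ) (hy.comp (hconsr a)) (fun i => (hB _).comp (hconsr a)) ?_
        intro i x
        simp only [Function.comp_apply, Fin.cons_update]
        exact h i.succ (Fin.cons a x))
      (fun b => by simpa only [Fin.update_cons_zero] using h 0 (Fin.cons a₀ b))
    rw [h1]
    refine h2.trans (le_of_eq ?_)
    have hs := integral_finsetSum (μ := (ν 0).prod (Measure.pi fun j => ν j.succ)) Finset.univ
      (f := fun (i : Fin n) p => B i.succ (Fin.cons p.1 p.2))
      fun i _ => integrable_of_continuous_compact _ ((hB i.succ).comp hcons)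
    rw [hs, Fin.sum_univ_succ, add_comm, integral_pi_succ ν (B 0)]
    congr 1
    exact Finset.sum_congr rfl fun i _ => (integral_pi_succ ν (B i.succ)).symm

/-- McDiarmid's exponential moment bound. -/
theorem integral_exp_pi_le {n : ℕ} (ν : Fin n → Measure K) [∀ i, IsProbabilityMeasure (ν i)]
    {y : (Fin n → K) → ℝ} (hy : Continuous y) {c : Fin n → ℝ}
    (h : ∀ i x r, |y x - y (Function.update x i r)| ≤ c i) :
    ∫ x, Real.exp (y x) ∂(Measure.pi ν) ≤
      Real.exp (∫ x, y x ∂(Measure.pi ν) + (∑ i, c i ^ 2) / 8) := by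
  induction n with
  | zero =>
    rw [Measure.pi_of_empty ν]
    simp
  | succ n ih =>
    have hcons : Continuous fun p : K × (Fin n → K) => (Fin.cons p.1 p.2 : Fin (n + 1) → K) :=
      Continuous.finCons continuous_fst continuous_snd
    have hconsr : ∀ a : K, Continuous fun b : Fin n → K => (Fin.cons a b : Fin (n + 1) → K) :=
      fun a => Continuous.finCons continuous_const continuous_id
    set π := Measure.pi fun j : Fin n => ν j.succ with hπ
    have hyc := hy.comp hcons
    -- Averaging out the other coordinates keeps the oscillation in the first below `c 0`, so
    -- Hoeffding's lemma applies to `g`; the induction hypothesis handles each slice.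
    set g : K → ℝ := fun a => ∫ b, y (Fin.cons a b) ∂π with hg
    have hgc : Continuous g :=
      continuous_integral_right π (f := fun a b => y (Fin.cons a b)) hyc
    have iy : Integrable (fun p : K × (Fin n → K) => y (Fin.cons p.1 p.2)) ((ν 0).prod π) :=
      integrable_of_continuous_compact _ hyc
    have ie : Integrable (fun p : K × (Fin n → K) => Real.exp (y (Fin.cons p.1 p.2)))
        ((ν 0).prod π) := integrable_of_continuous_compact _ (Real.continuous_exp.comp hyc)
    rw [integral_pi_succ ν (fun x => Real.exp (y x)), integral_pi_succ ν y, ← hπ,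
      integral_prod _ ie, integral_prod _ iy, Fin.sum_univ_succ]
    set S := ∑ i : Fin n, c i.succ ^ 2
    have h1 : ∀ a, ∫ b, Real.exp (y (Fin.cons a b)) ∂π ≤ Real.exp (g a) * Real.exp (S / 8) := by
      intro a
      rw [← Real.exp_add]
      refine ih (fun j => ν j.succ) (hy.comp (hconsr a)) (c := fun i => c i.succ) ?_
      intro i x r
      simp only [Function.comp_apply, Fin.cons_update]
      exact h i.succ (Fin.cons a x) r
    have h2 : ∀ a a', |g a - g a'| ≤ c 0 := by
      intro a a'
      have i1 := integrable_of_continuous_compact π (hy.comp (hconsr a))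
      have i2 := integrable_of_continuous_compact π (hy.comp (hconsr a'))
      have h3 : g a - g a' = ∫ b, (y (Fin.cons a b) - y (Fin.cons a' b)) ∂π :=
        (integral_sub i1 i2).symm
      rw [h3]
      have h4 := norm_integral_le_of_norm_le_const (μ := π)
        (f := fun b => y (Fin.cons a b) - y (Fin.cons a' b)) (C := c 0)
        (ae_of_all _ fun b => by
          have := h 0 (Fin.cons a b) a'
          rwa [Fin.update_cons_zero] at this)
      simpa using h4
    have h5 := integral_exp_le_of_oscillation (ν 0) hgc h2
    calc _ ≤ ∫ a, Real.exp (g a) * Real.exp (S / 8) ∂(ν 0) :=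
          integral_mono ie.integral_prod_left (integrable_of_continuous_compact _
            ((Real.continuous_exp.comp hgc).mul continuous_const)) h1
      _ = (∫ a, Real.exp (g a) ∂(ν 0)) * Real.exp (S / 8) := integral_mul_const _ _
      _ ≤ Real.exp (∫ a, g a ∂(ν 0) + c 0 ^ 2 / 8) * Real.exp (S / 8) := by gcongr
      _ = _ := by
          rw [← Real.exp_add]
          congr 1
          simp only [hg]
          ring

/-- McDiarmid's inequality. -/
theorem measureReal_pi_ge_le_exp {n : ℕ} (ν : Fin n → Measure K) [∀ i, IsProbabilityMeasure (ν i)]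
    {y : (Fin n → K) → ℝ} (hy : Continuous y) {c : Fin n → ℝ}
    (h : ∀ i x r, |y x - y (Function.update x i r)| ≤ c i) {m u : ℝ}
    (hm : ∫ x, y x ∂(Measure.pi ν) ≤ m) (hu : 0 < u) :
    (Measure.pi ν).real {x | m + u ≤ y x} ≤ Real.exp (-(2 * u ^ 2) / ∑ i, c i ^ 2) := by
  set S := ∑ i, c i ^ 2 with hS
  have hS0 : 0 ≤ S := Finset.sum_nonneg fun _ _ => sq_nonneg _
  -- If `S = 0`, division by zero makes the claimed bound `exp 0 = 1`, which is trivial.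
  rcases hS0.eq_or_lt with h0 | h0
  · rw [← h0, div_zero, Real.exp_zero]
    exact measureReal_le_one
  -- The minimiser of the Chernoff exponent `-θu + θ²S/8`.
  set θ := 4 * u / S with hθ
  have hθ0 : 0 < θ := by positivity
  have h1 := integral_exp_pi_le ν (y := fun x => θ * y x) (continuous_const.mul hy)
    (c := fun i => θ * c i) (fun i x r => by
      rw [← mul_sub, abs_mul, abs_of_pos hθ0]
      exact mul_le_mul_of_nonneg_left (h i x r) hθ0.le)
  have h2 := measure_ge_le_exp_mul_mgf (μ := Measure.pi ν) (X := y) (m + u) hθ0.le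
    (integrable_of_continuous_compact _ (by fun_prop))
  refine h2.trans ((mul_le_mul_of_nonneg_left h1 (Real.exp_pos _).le).trans ?_)
  rw [← Real.exp_add, Real.exp_le_exp, integral_const_mul]
  simp only [mul_pow, ← Finset.mul_sum, ← hS]
  have h3 : -θ * u + θ ^ 2 * S / 8 = -(2 * u ^ 2) / S := by
    rw [hθ]
    field_simp
    ring
  nlinarith [mul_le_mul_of_nonneg_left hm hθ0.le]

end Product

/-! ### Herbst's argument and the resulting tail. -/

section Herbst

variable {X : Type*} [TopologicalSpace X] [CompactSpace X] [MeasurableSpace X] [BorelSpace X]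

/-- Herbst's argument for an entropy bound of self-bounding type. -/
theorem cgf_mul_le_of_expEntropy_le (P : Measure X) [IsProbabilityMeasure P] {Z : X → ℝ}
    (hZ : Continuous Z) {c : ℝ}
    (h : ∀ θ > 0, expEntropy P (fun x => θ * Z x) ≤
      c * θ ^ 2 * ∫ x, Z x * Real.exp (θ * Z x) ∂P) {θ : ℝ} (hθ : 0 < θ) :
    cgf Z P θ * (θ⁻¹ - c) ≤ ∫ x, Z x ∂P := by
  have hset : integrableExpSet Z P = Set.univ := Set.eq_univ_of_forall fun t =>
    integrable_of_continuous_compact P (by fun_prop)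
  have hint : ∀ t, t ∈ interior (integrableExpSet Z P) := fun t => by simp [hset]
  have hd : ∀ t, HasDerivAt (cgf Z P) (deriv (cgf Z P) t) t := fun t =>
    (analyticAt_cgf (hint t)).differentiableAt.hasDerivAt
  -- The entropy hypothesis says exactly that `κ` has nonpositive derivative on `t > 0`. Its limit
  -- at `0⁺` is the slope of the cumulant generating function at `0`, which is the mean.
  set κ : ℝ → ℝ := fun t => cgf Z P t * (t⁻¹ - c) with hκ
  have hκd : ∀ t > 0, HasDerivAt κ
      (deriv (cgf Z P) t * (t⁻¹ - c) + cgf Z P t * (-(t ^ 2)⁻¹)) t := fun t ht =>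
    (hd t).mul ((hasDerivAt_inv ht.ne').sub_const c)
  have hanti : AntitoneOn κ (Set.Ioi 0) := by
    refine antitoneOn_of_deriv_nonpos (convex_Ioi 0)
      (fun t ht => (hκd t ht).continuousAt.continuousWithinAt)
      (fun t ht => by
        rw [interior_Ioi] at ht
        exact (hκd t ht).differentiableAt.differentiableWithinAt) ?_
    intro t ht
    rw [interior_Ioi] at ht
    have ht' : 0 < t := ht
    rw [(hκd t ht).deriv, deriv_cgf (hint t)]
    have h1 := h t ht
    have hM : 0 < mgf Z P t := mgf_pos (integrable_of_continuous_compact P (by fun_prop))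
    have hmgf : ∫ x, Real.exp (t * Z x) ∂P = mgf Z P t := rfl
    rw [expEntropy, hmgf] at h1
    simp only [mul_assoc, integral_const_mul] at h1
    set E := ∫ x, Z x * Real.exp (t * Z x) ∂P
    have hlog : Real.log (mgf Z P t) = cgf Z P t := rfl
    rw [hlog] at h1
    have : E / mgf Z P t * (t⁻¹ - c) + cgf Z P t * -(t ^ 2)⁻¹ =
        (t * E - mgf Z P t * cgf Z P t - c * (t ^ 2 * E)) / (mgf Z P t * t ^ 2) := by
      field_simp
      ring
    rw [this]
    exact div_nonpos_of_nonpos_of_nonneg (by linarith) (by positivity)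
  have hlim : Filter.Tendsto κ (nhdsWithin 0 (Set.Ioi 0)) (nhds (∫ x, Z x ∂P)) := by
    have h1 := (hd 0).tendsto_slope_zero_right
    rw [deriv_cgf_zero (hint 0)] at h1
    have h2 : Filter.Tendsto (cgf Z P) (nhdsWithin 0 (Set.Ioi 0)) (nhds 0) := by
      have := (hd 0).continuousAt.tendsto
      rw [cgf_zero] at this
      exact this.mono_left nhdsWithin_le_nhds
    have h3 := h1.sub (h2.mul_const c)
    simp only [probReal_univ, div_one, zero_mul, sub_zero, zero_add, cgf_zero, smul_eq_mul] at h3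
    refine h3.congr fun t => ?_
    simp only [hκ]
    ring
  refine ge_of_tendsto hlim ?_
  filter_upwards [Ioo_mem_nhdsGT hθ] with t ht
  exact hanti ht.1 hθ ht.2.le

theorem measureReal_ge_le_exp_of_expEntropy_le (P : Measure X) [IsProbabilityMeasure P] {Z : X → ℝ}
    (hZ : Continuous Z) {c : ℝ} (hc : 0 < c)
    (h : ∀ θ > 0, expEntropy P (fun x => θ * Z x) ≤
      c * θ ^ 2 * ∫ x, Z x * Real.exp (θ * Z x) ∂P) {m u : ℝ}
    (hm : ∫ x, Z x ∂P ≤ m) (hm0 : 0 < m) (hu : 0 < u) :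
    P.real {x | m + u ≤ Z x} ≤ Real.exp (-u ^ 2 / (2 * c * (2 * m + u))) := by
  -- With this `θ`, `θ⁻¹ - c = 2cm/u` is positive, so Herbst's bound can be divided by it and gives
  -- `cgf ≤ u / (2c)`.
  set θ := u / (c * (2 * m + u)) with hθ
  have hθ0 : 0 < θ := by positivity
  have h1 := cgf_mul_le_of_expEntropy_le P hZ h hθ0
  have h2 := measure_ge_le_exp_cgf (μ := P) (X := Z) (m + u) hθ0.le
    (integrable_of_continuous_compact _ (by fun_prop))
  refine h2.trans (Real.exp_le_exp.2 ?_)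
  have h3 : θ⁻¹ - c = 2 * c * m / u := by
    rw [hθ]
    field_simp
    ring
  rw [h3] at h1
  have h4 : cgf Z P θ ≤ u / (2 * c) := by
    have h5 : cgf Z P θ * (2 * c * m / u) ≤ u / (2 * c) * (2 * c * m / u) := by
      refine (h1.trans hm).trans (le_of_eq ?_)
      field_simp
    exact le_of_mul_le_mul_right h5 (by positivity)
  have h6 : -θ * (m + u) + u / (2 * c) = -u ^ 2 / (2 * c * (2 * m + u)) := by
    rw [hθ]
    field_simp
    ring
  linarith

end Herbst

/-! ### Concentration of a quadratic form. -/

section Quadratic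

open Matrix

/-- A convex function lies above its tangent at `u`; the gradient of `½‖A·‖²` there is `AᵀAu`. This
supplies the one-sided slope for the entropy bound. -/
theorem half_sum_sq_mulVec_sub_le {m n : Type*} [Fintype m] [Fintype n] (A : Matrix m n ℝ)
    {u v : n → ℝ} {i : n} (h : ∀ j, j ≠ i → u j = v j) :
    (1 / 2) * ∑ k, (A *ᵥ u) k ^ 2 - (1 / 2) * ∑ k, (A *ᵥ v) k ^ 2 ≤
      (Aᵀ *ᵥ (A *ᵥ u)) i * (u i - v i) := by
  have h1 : ∀ k, (A *ᵥ u) k - (A *ᵥ v) k = A k i * (u i - v i) := by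
    intro k
    rw [← Pi.sub_apply, ← Matrix.mulVec_sub, Matrix.mulVec, dotProduct,
      Finset.sum_eq_single i (fun j _ hj => by rw [Pi.sub_apply, h j hj, sub_self, mul_zero])
        (fun hi => absurd (Finset.mem_univ i) hi), Pi.sub_apply]
  rw [← mul_sub, ← Finset.sum_sub_distrib, Finset.mul_sum, Matrix.mulVec, dotProduct,
    Finset.sum_mul]
  refine Finset.sum_le_sum fun k _ => ?_
  rw [Matrix.transpose_apply, mul_right_comm, ← h1 k]
  nlinarith [sq_nonneg ((A *ᵥ u) k - (A *ᵥ v) k)]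

variable {K : Type*} [TopologicalSpace K] [CompactSpace K] [T2Space K]
  [SecondCountableTopology K] [MeasurableSpace K] [BorelSpace K]

/-- Concentration of a nonnegative quadratic form in independent bounded centred variables. -/
theorem measureReal_pi_quadratic_ge_le_exp {n : ℕ} {m : Type*} [Fintype m]
    (A : Matrix m (Fin n) ℝ) {l : ℝ} (hl : 0 < l)
    (hA : ∀ v, ∑ j, (Aᵀ *ᵥ v) j ^ 2 ≤ l * ∑ k, v k ^ 2)
    (ν : Fin n → Measure K) [∀ i, IsProbabilityMeasure (ν i)] {c : K → ℝ} (hc : Continuous c)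
    {ε : ℝ} (hε0 : 0 < ε) (hε : ∀ a, |c a| ≤ ε) (hc0 : ∀ i, ∫ a, c a ∂(ν i) = 0) {M u : ℝ}
    (hM : ∫ x, (1 / 2) * ∑ k, (A *ᵥ fun i => c (x i)) k ^ 2 ∂(Measure.pi ν) ≤ M) (hM0 : 0 < M)
    (hu : 0 < u) :
    (Measure.pi ν).real {x | M + u ≤ (1 / 2) * ∑ k, (A *ᵥ fun i => c (x i)) k ^ 2} ≤
      Real.exp (-u ^ 2 / (2 * (4 * ε ^ 2 * l) * (2 * M + u))) := by
  have hAc : ∀ k, Continuous fun x : Fin n → K => (A *ᵥ fun i => c (x i)) k := fun k => by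
    simp only [Matrix.mulVec, dotProduct]
    fun_prop
  have hdc : ∀ i, Continuous fun x : Fin n → K => (Aᵀ *ᵥ (A *ᵥ fun i => c (x i))) i := fun i => by
    simp only [Matrix.mulVec, dotProduct]
    fun_prop
  set Z : (Fin n → K) → ℝ := fun x => (1 / 2) * ∑ k, (A *ᵥ fun i => c (x i)) k ^ 2 with hZ
  have hZc : Continuous Z := by fun_prop
  refine measureReal_ge_le_exp_of_expEntropy_le (Measure.pi ν) hZc (by positivity) ?_ hM hM0 hu
  intro θ hθ
  set B : Fin n → (Fin n → K) → ℝ := fun i x =>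
    2 * ε ^ 2 * (θ * (Aᵀ *ᵥ (A *ᵥ fun i => c (x i))) i) ^ 2 * Real.exp (θ * Z x) with hB
  have hBc : ∀ i, Continuous (B i) := fun i => by
    have := hdc i
    fun_prop
  have h1 := expEntropy_pi_le ν (y := fun x => θ * Z x) (by fun_prop) hBc (fun i x => by
    have hup : Continuous fun r : K => Function.update x i r := by fun_prop
    refine expEntropy_le_integral_sq_mul_exp (ν i) hc (y := fun r => θ * Z (Function.update x i r))
      (d := fun r => θ * (Aᵀ *ᵥ (A *ᵥ fun j => c (Function.update x i r j))) i)
      (by fun_prop) (continuous_const.mul ((hdc i).comp hup)) hε (hc0 i) fun a b => ?_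
    have h2 := half_sum_sq_mulVec_sub_le A (u := fun j => c (Function.update x i a j))
      (v := fun j => c (Function.update x i b j)) (i := i) (fun j hj => by
        simp only [Function.update_of_ne hj])
    simp only [Function.update_self] at h2
    rw [← mul_sub, mul_assoc]
    exact mul_le_mul_of_nonneg_left h2 hθ.le)
  refine h1.trans ?_
  rw [← integral_finsetSum _ fun i _ => integrable_of_continuous_compact _ (hBc i),
    ← integral_const_mul]
  refine integral_mono (integrable_of_continuous_compact _ (by fun_prop))
    (integrable_of_continuous_compact _ (by fun_prop)) fun x => ?_
  -- The squared gradient is at most `l‖Ac‖² = 2lZ`: the form controls its own entropy, with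
  -- constant `4ε²l`.
  have h3 := hA (A *ᵥ fun i => c (x i))
  have h4 : ∑ i, B i x = 2 * ε ^ 2 * θ ^ 2 * (∑ i, (Aᵀ *ᵥ (A *ᵥ fun i => c (x i))) i ^ 2) *
      Real.exp (θ * Z x) := by
    simp only [hB]
    rw [Finset.mul_sum, Finset.sum_mul]
    exact Finset.sum_congr rfl fun i _ => by ring
  have h5 : ∑ k, (A *ᵥ fun i => c (x i)) k ^ 2 = 2 * Z x := by simp only [hZ]; ring
  rw [h5] at h3
  simp only [h4]
  calc _ ≤ 2 * ε ^ 2 * θ ^ 2 * (l * (2 * Z x)) * Real.exp (θ * Z x) := by gcongr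
    _ = _ := by ring

end Quadratic

/-! ### Continuous dependence of all quantities on the noise. -/

section Stability

open Filter Topology

/-- The stability estimate squeezes the distance between minimisers to zero; no selection of
minimisers matters. -/
theorem tendsto_of_solvesWindow {α : Type*} {l : Filter α} {β : ℝ} (hβ : 0 ≤ β) {a b : ℤ}
    {z x : α → ℤ → ℝ} {z₀ x₀ : ℤ → ℝ} (hx : ∀ i, SolvesWindow β (z i) a b (x i))
    (hx₀ : SolvesWindow β z₀ a b x₀)
    (hz : ∀ t ∈ Finset.Icc a b, Tendsto (fun i => z i t) l (𝓝 (z₀ t)))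
    (hp : Tendsto (fun i => x i (a - 1)) l (𝓝 (x₀ (a - 1)))) {t : ℤ} (ht : t ∈ Finset.Icc a b) :
    Tendsto (fun i => x i t) l (𝓝 (x₀ t)) := by
  have hbound : ∀ i, (x i t - x₀ t) ^ 2 ≤ ∑ t ∈ Finset.Icc a b, (z i t - z₀ t) ^ 2
      + 4 * β * |x i (a - 1) - x₀ (a - 1)| := fun i =>
    (Finset.single_le_sum (f := fun t => (x i t - x₀ t) ^ 2) (fun _ _ => sq_nonneg _) ht).trans
      ((hx i).sum_sq_sub_le hβ hx₀)
  have h1 : Tendsto (fun i => ∑ t ∈ Finset.Icc a b, (z i t - z₀ t) ^ 2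
      + 4 * β * |x i (a - 1) - x₀ (a - 1)|) l (𝓝 0) := by
    have h2 := tendsto_finsetSum (Finset.Icc a b) fun t ht =>
      ((hz t ht).sub_const (z₀ t)).pow 2
    have h3 := ((hp.sub_const (x₀ (a - 1))).abs).const_mul (4 * β)
    have h4 := h2.add h3
    simpa using h4
  have h5 := (squeeze_zero (fun i => sq_nonneg _) hbound h1).sqrt
  simp only [Real.sqrt_sq_eq_abs, Real.sqrt_zero] at h5
  exact tendsto_sub_nhds_zero_iff.1 ((tendsto_zero_iff_abs_tendsto_zero _).2 h5)

section Convergence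

variable {α : Type*} {l : Filter α} {T : ℕ} {E : α → ℤ → ℝ} {e₀ : ℤ → ℝ}

theorem tendsto_prediction (hE : ∀ s ∈ Finset.Icc (1 : ℤ) T, Tendsto (fun i => E i s) l (𝓝 (e₀ s)))
    (f yhat : ℤ → ℝ) {τ : ℤ} (hτ : τ ≤ T) (t : ℤ) :
    Tendsto (fun i => prediction f yhat (E i) τ t) l (𝓝 (prediction f yhat e₀ τ t)) :=
  (tendsto_finsetSum _ fun s hs => (hE s (by rw [Finset.mem_Icc] at hs ⊢; omega)).const_mul
    (f (t - s))).const_add _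

theorem tendsto_target (hE : ∀ s ∈ Finset.Icc (1 : ℤ) T, Tendsto (fun i => E i s) l (𝓝 (e₀ s)))
    (f yhat : ℤ → ℝ) {t : ℤ} (ht : t ≤ T) :
    Tendsto (fun i => target f yhat (E i) t) l (𝓝 (target f yhat e₀ t)) :=
  tendsto_prediction hE f yhat ht t

theorem tendsto_opt (hE : ∀ s ∈ Finset.Icc (1 : ℤ) T, Tendsto (fun i => E i s) l (𝓝 (e₀ s)))
    {β : ℝ} (hβ : 0 ≤ β) (f yhat : ℤ → ℝ) {t : ℤ} (ht : t ≤ T) :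
    Tendsto (fun i => opt β T (target f yhat (E i)) t) l (𝓝 (opt β T (target f yhat e₀) t)) := by
  have h1 := fun i => isOpt_opt β hβ T (target f yhat (E i))
  have h2 := isOpt_opt β hβ T (target f yhat e₀)
  have h0 : ∀ t ≤ 0, Tendsto (fun i => opt β T (target f yhat (E i)) t) l
      (𝓝 (opt β T (target f yhat e₀) t)) := fun t ht => by
    simp only [h2.1 t ht, fun i => (h1 i).1 t ht]
    exact tendsto_const_nhds
  rcases le_or_gt t 0 with h | h
  · exact h0 t h
  · exact tendsto_of_solvesWindow hβ (fun i => (h1 i).2) h2.2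
      (fun t ht => tendsto_target hE f yhat (Finset.mem_Icc.1 ht).2) (h0 _ (by norm_num))
      (Finset.mem_Icc.2 ⟨by omega, ht⟩)

theorem tendsto_fhc (hE : ∀ s ∈ Finset.Icc (1 : ℤ) T, Tendsto (fun i => E i s) l (𝓝 (e₀ s)))
    {β : ℝ} (hβ : 0 ≤ β) (w : ℕ) (f yhat : ℤ → ℝ) (k : ℕ) {t : ℤ} (ht : t ≤ T) :
    Tendsto (fun i => fhc β w T f yhat (E i) k t) l (𝓝 (fhc β w T f yhat e₀ k t)) := by
  have h1 := fun i => isFHC_fhc β hβ w T k f yhat (E i)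
  have h2 := isFHC_fhc β hβ w T k f yhat e₀
  -- Induction on time: the window containing `t` starts from an earlier action, already known to
  -- converge.
  have key : ∀ n : ℕ, ∀ t : ℤ, t ≤ n → t ≤ T →
      Tendsto (fun i => fhc β w T f yhat (E i) k t) l (𝓝 (fhc β w T f yhat e₀ k t)) := by
    intro n
    induction n with
    | zero =>
      intro t ht _
      simp only [h2.1 t ht, fun i => (h1 i).1 t ht]
      exact tendsto_const_nhds
    | succ n ih =>
      intro t ht hT
      rcases le_or_gt t n with h | h
      · exact ih t h hT
      · obtain ⟨τ, hτ, h3, h4⟩ := exists_startTime w T k (by omega : 1 ≤ t) hT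
        push_cast at ht
        exact tendsto_of_solvesWindow hβ (fun i => (h1 i).2 τ hτ) (h2.2 τ hτ)
          (fun t _ => tendsto_prediction hE f yhat (by omega) t)
          (ih _ (by omega) (by omega)) (Finset.mem_Icc.2 ⟨by omega, by omega⟩)
  exact key t.toNat t (by omega) ht

theorem tendsto_g1 (hE : ∀ s ∈ Finset.Icc (1 : ℤ) T, Tendsto (fun i => E i s) l (𝓝 (e₀ s)))
    {β : ℝ} (hβ : 0 ≤ β) (w : ℕ) (f yhat : ℤ → ℝ) :
    Tendsto (fun i => g1 β w T f yhat (E i)) l (𝓝 (g1 β w T f yhat e₀)) := by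
  refine (tendsto_finsetSum _ fun k _ => tendsto_finsetSum _ fun τ hτ => ?_).const_mul _
  have := (mem_startTimes.1 hτ).1.2
  exact (((tendsto_opt hE hβ f yhat (by omega)).sub
    (tendsto_fhc hE hβ w f yhat k (by omega))).abs).const_mul _

theorem tendsto_g2 (hE : ∀ s ∈ Finset.Icc (1 : ℤ) T, Tendsto (fun i => E i s) l (𝓝 (e₀ s)))
    (w : ℕ) (f yhat : ℤ → ℝ) :
    Tendsto (fun i => g2 w T f yhat (E i)) l (𝓝 (g2 w T f yhat e₀)) := by
  refine Tendsto.const_mul _ (tendsto_finsetSum _ fun k _ => tendsto_finsetSum _ fun τ hτ =>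
    tendsto_finsetSum _ fun t ht => ?_)
  have := (mem_startTimes.1 hτ).1.2
  exact (((tendsto_target hE f yhat (mem_windowSlots.1 ht).1.2).sub
    (tendsto_prediction hE f yhat (by omega) t)).pow 2).const_mul _

theorem tendsto_cost {y x : α → ℤ → ℝ} {y₀ x₀ : ℤ → ℝ} (β : ℝ)
    (hy : ∀ t ≤ (T : ℤ), Tendsto (fun i => y i t) l (𝓝 (y₀ t)))
    (hx : ∀ t ≤ (T : ℤ), Tendsto (fun i => x i t) l (𝓝 (x₀ t))) :
    Tendsto (fun i => cost β T (y i) (x i)) l (𝓝 (cost β T y₀ x₀)) := by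
  unfold cost windowCost
  refine tendsto_finsetSum _ fun t ht => ?_
  rw [Finset.mem_Icc] at ht
  have hx' := hx t ht.2
  exact ((((hy t ht.2).sub hx').pow 2).const_mul _).add
    ((hx'.sub (hx (t - 1) (by omega))).abs.const_mul _)

theorem tendsto_competitiveDifference
    (hE : ∀ s ∈ Finset.Icc (1 : ℤ) T, Tendsto (fun i => E i s) l (𝓝 (e₀ s)))
    {β : ℝ} (hβ : 0 ≤ β) (w : ℕ) (f yhat : ℤ → ℝ) :
    Tendsto (fun i => competitiveDifference β w T f yhat (E i)) l
      (𝓝 (competitiveDifference β w T f yhat e₀)) := by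
  have hy := fun t (ht : t ≤ (T : ℤ)) => tendsto_target hE f yhat ht
  refine (tendsto_cost β hy fun t ht => ?_).sub
    (tendsto_cost β hy fun t ht => tendsto_opt hE hβ f yhat ht)
  exact (tendsto_finsetSum _ fun k _ => tendsto_fhc hE hβ w f yhat k ht).const_mul _

end Convergence

end Stability

/-! ### Bounding the first penalty by prediction errors. -/

/-- The error at time `t` of the prediction made `w + 1` slots earlier. -/
noncomputable def noiseSum (f : ℤ → ℝ) (w : ℕ) (e : ℤ → ℝ) (t : ℤ) : ℝ :=
  ∑ s ∈ Finset.Icc (max (t - w) 1) t, f (t - s) * e s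

/-- Both actions are compared with the target at `τ - 1`. The optimum may be off by `2β`; the
algorithm is off by `β` plus the error of a prediction made at the start of its previous window. -/
theorem abs_opt_sub_fhc_le {β : ℝ} (hβ : 0 ≤ β) {w T k : ℕ} (f yhat e : ℤ → ℝ) {τ : ℤ}
    (hτ : τ ∈ startTimes w T k) :
    |opt β T (target f yhat e) (τ - 1) - fhc β w T f yhat e k (τ - 1)| ≤
      if 2 ≤ τ then 3 * β + |noiseSum f w e (τ - 1)| else 0 := by
  have hopt := isOpt_opt β hβ T (target f yhat e)
  have hfhc := isFHC_fhc β hβ w T k f yhat e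
  split_ifs with h
  · have hm := mem_startTimes.1 hτ
    have hτ' : τ - 1 - w ∈ startTimes w T k := by
      refine mem_startTimes.2 ⟨⟨by omega, by omega⟩, ?_⟩
      have : τ - 1 - w ≡ τ [ZMOD ((w : ℤ) + 1)] := by
        rw [Int.modEq_iff_dvd]
        exact ⟨1, by ring⟩
      exact this.trans hm.2
    have h1 := hopt.2.abs_sub_le hβ (t := τ - 1) (Finset.mem_Icc.2 ⟨by omega, by omega⟩)
    have h2 := (hfhc.2 _ hτ').abs_sub_le hβ (t := τ - 1)
      (Finset.mem_Icc.2 ⟨by omega, by omega⟩)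
    -- Slot `τ - 1` is the last of the window starting at `τ - 1 - w`, so no following switching
    -- term contributes.
    rw [if_neg (by rw [Finset.mem_Icc]; omega), add_zero] at h2
    have h3 := target_sub_prediction f yhat e (τ := τ - 1 - w) (t := τ - 1) (by omega)
    have h4 : |target f yhat e (τ - 1) - opt β T (target f yhat e) (τ - 1)| ≤ 2 * β :=
      h1.trans (by split_ifs <;> linarith)
    rw [noiseSum, ← h3]
    rw [abs_le] at h2 h4 ⊢
    have h5 := neg_abs_le (target f yhat e (τ - 1) - prediction f yhat e (τ - 1 - w - 1) (τ - 1))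
    have h6 := le_abs_self (target f yhat e (τ - 1) - prediction f yhat e (τ - 1 - w - 1) (τ - 1))
    constructor <;> linarith
  · rw [hopt.1 _ (by omega), hfhc.1 _ (by omega)]
    simp

theorem g1_le {β : ℝ} (hβ : 0 ≤ β) (w : ℕ) {T : ℕ} (f yhat e : ℤ → ℝ) :
    g1 β w T f yhat e ≤ 3 * β ^ 2 * T / ((w : ℝ) + 1)
      + β / ((w : ℝ) + 1) * ∑ t ∈ Finset.Icc (1 : ℤ) (T - 1), |noiseSum f w e t| := by
  have h1 : ∑ k ∈ Finset.range (w + 1), ∑ τ ∈ startTimes w T k,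
      β * |opt β T (target f yhat e) (τ - 1) - fhc β w T f yhat e k (τ - 1)| ≤
      ∑ k ∈ Finset.range (w + 1), ∑ τ ∈ startTimes w T k,
        if 2 ≤ τ then 3 * β ^ 2 + β * |noiseSum f w e (τ - 1)| else 0 := by
    refine Finset.sum_le_sum fun k _ => Finset.sum_le_sum fun τ hτ => ?_
    have := mul_le_mul_of_nonneg_left (abs_opt_sub_fhc_le hβ f yhat e hτ) hβ
    split_ifs at this ⊢ <;> linarith
  rw [sum_range_sum_startTimes, ← Finset.sum_filter] at h1
  have h2 : ∑ τ ∈ Finset.Icc (-(w : ℤ)) T with 2 ≤ τ,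
      (3 * β ^ 2 + β * |noiseSum f w e (τ - 1)|) =
      ∑ t ∈ Finset.Icc (1 : ℤ) (T - 1), (3 * β ^ 2 + β * |noiseSum f w e t|) := by
    refine Finset.sum_nbij' (fun τ => τ - 1) (fun t => t + 1) ?_ ?_ ?_ ?_ ?_
    · intro τ hτ; simp only [Finset.mem_filter, Finset.mem_Icc] at hτ ⊢; omega
    · intro τ hτ; simp only [Finset.mem_filter, Finset.mem_Icc] at hτ ⊢; omega
    · intro τ _; ring
    · intro τ _; ring
    · intro τ _; rfl
  rw [h2, Finset.sum_add_distrib, Finset.sum_const, nsmul_eq_mul, ← Finset.mul_sum] at h1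
  have h3 : ((Finset.Icc (1 : ℤ) (T - 1)).card : ℝ) ≤ T := by
    rw [Int.card_Icc]
    exact_mod_cast (by omega : ((T : ℤ) - 1 + 1 - 1).toNat ≤ T)
  have h4 := mul_le_mul_of_nonneg_right h3 (by positivity : 0 ≤ 3 * β ^ 2)
  rw [g1]
  calc _ ≤ (1 / ((w : ℝ) + 1)) * (T * (3 * β ^ 2)
        + β * ∑ t ∈ Finset.Icc (1 : ℤ) (T - 1), |noiseSum f w e t|) := by
        gcongr
        exact h1.trans (by gcongr)
    _ = _ := by ring

/-! ### Second moments of the noise. -/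

section Moments

variable {Ω : Type*} [MeasurableSpace Ω] {μ : Measure Ω} [IsProbabilityMeasure μ] {T : ℕ}
  {σ ε : ℝ} {e : ℤ → Ω → ℝ}

theorem integrable_noise_mul (hm : ∀ s ∈ Finset.Icc (1 : ℤ) T, AEMeasurable (e s) μ)
    (hbdd : ∀ s ∈ Finset.Icc (1 : ℤ) T, ∀ᵐ ω ∂μ, |e s ω| ≤ ε) {s t : ℤ}
    (hs : s ∈ Finset.Icc (1 : ℤ) T) (ht : t ∈ Finset.Icc (1 : ℤ) T) :
    Integrable (fun ω => e s ω * e t ω) μ := by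
  refine Integrable.of_bound ((hm s hs).mul (hm t ht)).aestronglyMeasurable (ε * ε) ?_
  filter_upwards [hbdd s hs, hbdd t ht] with ω h1 h2
  rw [Real.norm_eq_abs, abs_mul]
  exact mul_le_mul h1 h2 (abs_nonneg _) ((abs_nonneg _).trans h1)

theorem sq_sum_mul_eq (S : Finset ℤ) (c : ℤ → ℝ) (x : ℤ → ℝ) :
    (∑ s ∈ S, c s * x s) ^ 2 = ∑ s ∈ S, ∑ t ∈ S, c s * c t * (x s * x t) := by
  rw [sq, Finset.sum_mul_sum]
  exact Finset.sum_congr rfl fun s _ => Finset.sum_congr rfl fun t _ => by ring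

theorem integrable_sq_sum_noise (hm : ∀ s ∈ Finset.Icc (1 : ℤ) T, AEMeasurable (e s) μ)
    (hbdd : ∀ s ∈ Finset.Icc (1 : ℤ) T, ∀ᵐ ω ∂μ, |e s ω| ≤ ε) {S : Finset ℤ}
    (hS : S ⊆ Finset.Icc (1 : ℤ) T) (c : ℤ → ℝ) :
    Integrable (fun ω => (∑ s ∈ S, c s * e s ω) ^ 2) μ := by
  simp only [fun ω => sq_sum_mul_eq S c (fun s => e s ω)]
  exact integrable_finsetSum _ fun s hs => integrable_finsetSum _ fun t ht =>
    (integrable_noise_mul hm hbdd (hS hs) (hS ht)).const_mul _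

/-- Independence and zero means remove the off-diagonal products. -/
theorem integral_sq_sum_noise (hindep : iIndepFun (fun s : Slot T => e s) μ)
    (hm : ∀ s ∈ Finset.Icc (1 : ℤ) T, AEMeasurable (e s) μ)
    (hmean : ∀ s ∈ Finset.Icc (1 : ℤ) T, ∫ ω, e s ω ∂μ = 0)
    (hvar : ∀ s ∈ Finset.Icc (1 : ℤ) T, ∫ ω, e s ω ^ 2 ∂μ = σ ^ 2)
    (hbdd : ∀ s ∈ Finset.Icc (1 : ℤ) T, ∀ᵐ ω ∂μ, |e s ω| ≤ ε) {S : Finset ℤ}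
    (hS : S ⊆ Finset.Icc (1 : ℤ) T) (c : ℤ → ℝ) :
    ∫ ω, (∑ s ∈ S, c s * e s ω) ^ 2 ∂μ = σ ^ 2 * ∑ s ∈ S, c s ^ 2 := by
  simp only [fun ω => sq_sum_mul_eq S c (fun s => e s ω)]
  rw [integral_finsetSum _ fun s hs => integrable_finsetSum _ fun t ht =>
    (integrable_noise_mul hm hbdd (hS hs) (hS ht)).const_mul _, Finset.mul_sum]
  refine Finset.sum_congr rfl fun s hs => ?_
  rw [integral_finsetSum _ fun t ht => (integrable_noise_mul hm hbdd (hS hs) (hS ht)).const_mul _,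
    Finset.sum_eq_single s]
  · rw [integral_const_mul]
    simp only [← sq]
    rw [hvar s (hS hs)]
    ring
  · intro t ht hts
    rw [integral_const_mul]
    have hind : IndepFun (e s) (e t) μ := hindep.indepFun
      (i := ⟨s, hS hs⟩) (j := ⟨t, hS ht⟩) (fun h => hts (congrArg Subtype.val h).symm)
    have := hind.integral_mul_eq_mul_integral (hm s (hS hs)).aestronglyMeasurable
      (hm t (hS ht)).aestronglyMeasurable
    simp only [Pi.mul_apply] at this
    rw [this, hmean s (hS hs)]
    ring
  · exact fun h => absurd hs h

/-- If `ε` were zero the first noise variable would vanish almost surely, against its variance. -/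
theorem bound_pos (hT : 1 ≤ T) (hσ : 0 < σ)
    (hvar : ∀ s ∈ Finset.Icc (1 : ℤ) T, ∫ ω, e s ω ^ 2 ∂μ = σ ^ 2)
    (hbdd : ∀ s ∈ Finset.Icc (1 : ℤ) T, ∀ᵐ ω ∂μ, |e s ω| ≤ ε) : 0 < ε := by
  have h1 : (1 : ℤ) ∈ Finset.Icc (1 : ℤ) T := Finset.mem_Icc.2 ⟨le_rfl, by omega⟩
  have hb := hbdd 1 h1
  obtain ⟨ω, hω⟩ := hb.exists
  refine lt_of_le_of_ne ((abs_nonneg _).trans hω) fun h0 => ?_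
  have h2 : (fun ω => e 1 ω ^ 2) =ᵐ[μ] fun _ => 0 := by
    filter_upwards [hb] with ω hω
    rw [← h0] at hω
    rw [abs_nonpos_iff.1 hω]
    norm_num
  have h3 := hvar 1 h1
  rw [integral_congr_ae h2, integral_zero] at h3
  have : 0 < σ ^ 2 := by positivity
  linarith

end Moments

/-! ### Transfer to a compact product space. -/

/-- The noise path with values `x` in the slots `1, …, T`. -/
noncomputable def noisePath {T n : ℕ} {ε : ℝ} (q : Slot T ≃ Fin n)
    (x : Fin n → Set.Icc (-ε) ε) (s : ℤ) : ℝ :=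
  if h : s ∈ Finset.Icc (1 : ℤ) T then (x (q ⟨s, h⟩) : ℝ) else 0

theorem noisePath_of_mem {T n : ℕ} {ε : ℝ} (q : Slot T ≃ Fin n) (x : Fin n → Set.Icc (-ε) ε)
    (s : Slot T) : noisePath q x s = x (q s) := dif_pos s.2

theorem continuous_noisePath {T n : ℕ} {ε : ℝ} (q : Slot T ≃ Fin n) (s : ℤ) :
    Continuous fun x : Fin n → Set.Icc (-ε) ε => noisePath q x s := by
  unfold noisePath
  split_ifs with h
  · fun_prop
  · exact continuous_const

/-- A function of the noise path that is continuous in the values on the slots `1, …, T`. -/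
def ContinuousOnSlots (T : ℕ) (φ : (ℤ → ℝ) → ℝ) : Prop :=
  ∀ (α : Type) (l : Filter α) (E : α → ℤ → ℝ) (e₀ : ℤ → ℝ),
    (∀ s ∈ Finset.Icc (1 : ℤ) T, Filter.Tendsto (fun i => E i s) l (nhds (e₀ s))) →
      Filter.Tendsto (fun i => φ (E i)) l (nhds (φ e₀))

/-- A constant family equal to `e` converges on the slots to `e'`, so uniqueness of limits
identifies the two values. -/
theorem ContinuousOnSlots.congr {T : ℕ} {φ : (ℤ → ℝ) → ℝ} (hφ : ContinuousOnSlots T φ)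
    {e e' : ℤ → ℝ} (h : ∀ s ∈ Finset.Icc (1 : ℤ) T, e s = e' s) : φ e = φ e' := by
  have := hφ Unit (pure ()) (fun _ => e) e' fun s hs => by
    rw [h s hs]
    exact tendsto_const_nhds
  exact tendsto_nhds_unique tendsto_const_nhds this

theorem ContinuousOnSlots.continuous_noisePath {T n : ℕ} {ε : ℝ} {φ : (ℤ → ℝ) → ℝ}
    (hφ : ContinuousOnSlots T φ) (q : Slot T ≃ Fin n) :
    Continuous fun x : Fin n → Set.Icc (-ε) ε => φ (noisePath q x) :=
  continuous_iff_continuousAt.2 fun x => hφ _ _ _ _ fun s _ =>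
    (OnlineLasso.continuous_noisePath q s).tendsto x

/-- Bounded independent noise is realised on a product of compact intervals. -/
theorem exists_compact_model {Ω : Type*} [MeasurableSpace Ω] {μ : Measure Ω}
    [IsProbabilityMeasure μ] {T : ℕ} {ε : ℝ} (hε : 0 < ε) {e : ℤ → Ω → ℝ}
    (hindep : iIndepFun (fun s : Slot T => e s) μ)
    (hm : ∀ s ∈ Finset.Icc (1 : ℤ) T, AEMeasurable (e s) μ)
    (hmean : ∀ s ∈ Finset.Icc (1 : ℤ) T, ∫ ω, e s ω ∂μ = 0)
    (hbdd : ∀ s ∈ Finset.Icc (1 : ℤ) T, ∀ᵐ ω ∂μ, |e s ω| ≤ ε) {n : ℕ} (q : Slot T ≃ Fin n) :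
    ∃ ν : Fin n → Measure (Set.Icc (-ε) ε), ∃ _ : ∀ i, IsProbabilityMeasure (ν i),
      (∀ i, ∫ a, (a : ℝ) ∂(ν i) = 0) ∧
      ∀ φ : (ℤ → ℝ) → ℝ, ContinuousOnSlots T φ →
        Integrable (fun ω => φ fun s => e s ω) μ ∧
        ∫ ω, φ (fun s => e s ω) ∂μ = ∫ x, φ (noisePath q x) ∂(Measure.pi ν) ∧
        ∀ r, μ.real {ω | r ≤ φ fun s => e s ω} =
          (Measure.pi ν).real {x | r ≤ φ (noisePath q x)} := by
  have hεε : -ε ≤ ε := by linarith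
  -- Clamping the noise to `[-ε, ε]` changes it only on a null set and keeps independence, so the
  -- joint law is a product of measures on a compact interval.
  set X : Fin n → Ω → Set.Icc (-ε) ε := fun i ω => Set.projIcc (-ε) ε hεε (e (q.symm i) ω) with hX
  have hXm : ∀ i, AEMeasurable (X i) μ := fun i =>
    continuous_projIcc.measurable.comp_aemeasurable (hm _ (q.symm i).2)
  have hXe : ∀ s : Slot T, ∀ᵐ ω ∂μ, (X (q s) ω : ℝ) = e s ω := by
    intro s
    filter_upwards [hbdd s s.2] with ω hω
    simp only [hX, Equiv.symm_apply_apply]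
    rw [Set.projIcc_of_mem hεε (abs_le.1 hω)]
  have hXi : iIndepFun X μ :=
    (hindep.precomp q.symm.injective).comp (fun _ => Set.projIcc (-ε) ε hεε)
      fun _ => continuous_projIcc.measurable
  have hpi := hXi.map_fun_eq_pi_map hXm
  have hXm' : AEMeasurable (fun ω i => X i ω) μ := aemeasurable_pi_lambda _ hXm
  refine ⟨fun i => μ.map (X i), fun i => Measure.isProbabilityMeasure_map (hXm i), ?_, ?_⟩
  · intro i
    rw [integral_map (hXm i) continuous_subtype_val.aestronglyMeasurable,
      ← hmean (q.symm i) (q.symm i).2]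
    refine integral_congr_ae ?_
    have := hXe (q.symm i)
    rwa [Equiv.apply_symm_apply] at this
  · intro φ hφ
    have hc := hφ.continuous_noisePath (ε := ε) q
    have hae : ∀ᵐ ω ∂μ, φ (noisePath q fun i => X i ω) = φ fun s => e s ω := by
      filter_upwards [ae_all_iff.2 hXe] with ω hω
      refine hφ.congr fun s hs => ?_
      exact (noisePath_of_mem q _ ⟨s, hs⟩).trans (hω ⟨s, hs⟩)
    have hint : Integrable (fun x => φ (noisePath q x)) (μ.map fun ω i => X i ω) := by
      have := Measure.isProbabilityMeasure_map hXm'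
      exact integrable_of_continuous_compact _ hc
    refine ⟨?_, ?_, fun r => ?_⟩
    · exact (hint.comp_aemeasurable hXm').congr hae
    · rw [← hpi, integral_map hXm' hint.aestronglyMeasurable]
      exact (integral_congr_ae hae).symm
    · rw [← hpi, map_measureReal_apply_of_aemeasurable hXm'
        (measurableSet_le measurable_const hc.measurable)]
      refine measureReal_congr ?_
      filter_upwards [hae] with ω hω
      exact congrArg (fun v => r ≤ v) hω.symm

theorem continuousOnSlots_g1 {β : ℝ} (hβ : 0 ≤ β) (w T : ℕ) (f yhat : ℤ → ℝ) :
    ContinuousOnSlots T (g1 β w T f yhat) := fun _ _ _ _ hE => tendsto_g1 hE hβ w f yhat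

theorem continuousOnSlots_g2 (w T : ℕ) (f yhat : ℤ → ℝ) :
    ContinuousOnSlots T (g2 w T f yhat) := fun _ _ _ _ hE => tendsto_g2 hE w f yhat

theorem continuousOnSlots_competitiveDifference {β : ℝ} (hβ : 0 ≤ β) (w T : ℕ) (f yhat : ℤ → ℝ) :
    ContinuousOnSlots T (competitiveDifference β w T f yhat) :=
  fun _ _ _ _ hE => tendsto_competitiveDifference hE hβ w f yhat

theorem continuousOnSlots_sum_noiseSum (T : ℕ) (f : ℤ → ℝ) (w : ℕ) (c : ℝ) :
    ContinuousOnSlots T fun e => c * ∑ t ∈ Finset.Icc (1 : ℤ) (T - 1), |noiseSum f w e t| := by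
  intro _ _ E e₀ hE
  refine (tendsto_finsetSum _ fun t ht => (tendsto_finsetSum _ fun s hs => ?_).abs).const_mul _
  rw [Finset.mem_Icc] at ht hs
  exact (hE s (Finset.mem_Icc.2 ⟨by omega, by omega⟩)).const_mul _

/-! ### Positivity, sensitivity and sums of squared entries. -/

theorem fNormSq_pos {σ : ℝ} (hσ : 0 < σ) {f : ℤ → ℝ} (hf0 : f 0 = 1) (w : ℕ) :
    0 < fNormSq σ f w := by
  have h : f ((0 : ℕ) : ℤ) ^ 2 ≤ ∑ s ∈ Finset.range (w + 1), f s ^ 2 :=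
    Finset.single_le_sum (f := fun s : ℕ => f s ^ 2) (fun _ _ => sq_nonneg _)
      (Finset.mem_range.2 (Nat.succ_pos w))
  rw [Nat.cast_zero, hf0, one_pow] at h
  unfold fNormSq
  have : 0 < σ ^ 2 := by positivity
  nlinarith

theorem bigF_pos {σ : ℝ} (hσ : 0 < σ) {f : ℤ → ℝ} (hf0 : f 0 = 1) (w : ℕ) : 0 < bigF σ f w := by
  -- Horizon `1` suffices, since the block norm does not involve `T`.
  have h := (topEigenvalue_pos w le_rfl hf0).trans_le (topEigenvalue_le w 1 f)
  rw [bigF_eq]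
  positivity

theorem sum_sq_le_fNormSq {σ : ℝ} (f : ℤ → ℝ) (w : ℕ) (t : ℤ) :
    σ ^ 2 * ∑ s ∈ Finset.Icc (max (t - w) 1) t, f (t - s) ^ 2 ≤ fNormSq σ f w := by
  unfold fNormSq
  gcongr
  exact sum_Icc_comp_sub_left_le (g := fun i => f i ^ 2) (fun _ => sq_nonneg _) (by omega)

/-- The sensitivity of the accumulated prediction errors to one noise value. -/
theorem abs_sum_abs_noiseSum_sub_le (f : ℤ → ℝ) (w : ℕ) (N : ℤ) {e e' : ℤ → ℝ} {s₀ : ℤ} {d : ℝ}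
    (h : ∀ s, s ≠ s₀ → e s = e' s) (hd : |e s₀ - e' s₀| ≤ d) :
    abs (∑ t ∈ Finset.Icc (1 : ℤ) N, |noiseSum f w e t|
        - ∑ t ∈ Finset.Icc (1 : ℤ) N, |noiseSum f w e' t|) ≤
      d * ∑ j ∈ Finset.range (w + 1), |f j| := by
  have hd0 : 0 ≤ d := (abs_nonneg _).trans hd
  -- The noise at `s₀` enters only the errors at times `s₀, …, s₀ + w`, with coefficient `f (t -
  -- s₀)`.
  have h1 : ∀ t, abs (|noiseSum f w e t| - |noiseSum f w e' t|) ≤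
      if t ∈ Finset.Icc s₀ (s₀ + w) then d * |f (t - s₀)| else 0 := by
    intro t
    refine (abs_abs_sub_abs_le _ _).trans ?_
    have h2 : noiseSum f w e t - noiseSum f w e' t = ∑ s ∈ Finset.Icc (max (t - w) 1) t,
        if s = s₀ then f (t - s₀) * (e s₀ - e' s₀) else 0 := by
      unfold noiseSum
      rw [← Finset.sum_sub_distrib]
      refine Finset.sum_congr rfl fun s _ => ?_
      split_ifs with hs
      · rw [hs, mul_sub]
      · rw [h s hs, sub_self]
    rw [h2, Finset.sum_ite_eq']
    by_cases hs : s₀ ∈ Finset.Icc (max (t - w) 1) t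
    · rw [if_pos hs, if_pos (by rw [Finset.mem_Icc] at hs ⊢; omega), abs_mul, mul_comm d]
      exact mul_le_mul_of_nonneg_left hd (abs_nonneg _)
    · rw [if_neg hs, abs_zero]
      split_ifs
      · exact mul_nonneg hd0 (abs_nonneg _)
      · exact le_rfl
  rw [← Finset.sum_sub_distrib]
  refine (Finset.abs_sum_le_sum_abs _ _).trans ((Finset.sum_le_sum fun t _ => h1 t).trans ?_)
  rw [← Finset.sum_filter]
  calc ∑ t ∈ Finset.Icc (1 : ℤ) N with t ∈ Finset.Icc s₀ (s₀ + w), d * |f (t - s₀)|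
      ≤ ∑ t ∈ Finset.Icc s₀ (s₀ + w), d * |f (t - s₀)| :=
        Finset.sum_le_sum_of_subset_of_nonneg
          (fun t ht => (Finset.mem_filter.1 ht).2) fun _ _ _ => by positivity
    _ ≤ _ := by
        rw [← Finset.mul_sum]
        refine mul_le_mul_of_nonneg_left ?_ hd0
        exact sum_Icc_comp_sub_right_le (g := fun i => |f i|) (fun _ => abs_nonneg _) (by omega)

/-- After exchanging sums, a slot `t` is met by windows starting at `t - w, …, t`. It thus occupies
each row position of a full block at most once, and contributes at most one block norm. -/
theorem sum_windows_sq_le (w T : ℕ) (f : ℤ → ℝ) :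
    ∑ k ∈ Finset.range (w + 1), ∑ τ ∈ startTimes w T k, ∑ t ∈ windowSlots w T τ,
      ∑ s ∈ Finset.Icc (max τ 1) t, f (t - s) ^ 2 ≤ T * blockNormSq f w := by
  set q : ℤ → ℝ := fun i => ∑ j ∈ Finset.range (i.toNat + 1), f j ^ 2 with hq
  have hq0 : ∀ i, 0 ≤ q i := fun i => Finset.sum_nonneg fun _ _ => sq_nonneg _
  rw [sum_range_sum_startTimes w T (fun τ => ∑ t ∈ windowSlots w T τ,
    ∑ s ∈ Finset.Icc (max τ 1) t, f (t - s) ^ 2)]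
  calc _ ≤ ∑ τ ∈ Finset.Icc (-(w : ℤ)) T, ∑ t ∈ windowSlots w T τ, q (t - τ) := by
        refine Finset.sum_le_sum fun τ _ => Finset.sum_le_sum fun t ht => ?_
        have ht' := mem_windowSlots.1 ht
        exact sum_Icc_comp_sub_left_le (g := fun i => f i ^ 2) (i := (t - τ).toNat)
          (fun _ => sq_nonneg _) (by omega)
    _ = ∑ t ∈ Finset.Icc (1 : ℤ) T, ∑ τ ∈ Finset.Icc (t - w) t, q (t - τ) := by
        refine Finset.sum_comm' fun τ t => ?_
        rw [mem_windowSlots, Finset.mem_Icc, Finset.mem_Icc, Finset.mem_Icc]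
        omega
    _ ≤ ∑ t ∈ Finset.Icc (1 : ℤ) T, blockNormSq f w := by
        refine Finset.sum_le_sum fun t _ => ?_
        refine (sum_Icc_comp_sub_left_le (g := q) (i := w) hq0 (by omega)).trans (le_of_eq ?_)
        rw [blockNormSq, ← sum_range_triangle (fun j => f j ^ 2)]
        simp only [hq, Int.toNat_natCast]
    _ = _ := by
        rw [Finset.sum_const, Int.card_Icc, nsmul_eq_mul]
        congr 2
        omega

/-! ### Means and tails of the two penalties. -/

section Noise

variable {Ω : Type*} [MeasurableSpace Ω] {μ : Measure Ω} [IsProbabilityMeasure μ] {T : ℕ}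
  {σ ε : ℝ} {e : ℤ → Ω → ℝ}

theorem integral_abs_noiseSum_le (hindep : iIndepFun (fun s : Slot T => e s) μ)
    (hm : ∀ s ∈ Finset.Icc (1 : ℤ) T, AEMeasurable (e s) μ)
    (hmean : ∀ s ∈ Finset.Icc (1 : ℤ) T, ∫ ω, e s ω ∂μ = 0)
    (hvar : ∀ s ∈ Finset.Icc (1 : ℤ) T, ∫ ω, e s ω ^ 2 ∂μ = σ ^ 2)
    (hbdd : ∀ s ∈ Finset.Icc (1 : ℤ) T, ∀ᵐ ω ∂μ, |e s ω| ≤ ε) (hσ : 0 < σ)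
    {f : ℤ → ℝ} (hf0 : f 0 = 1) (w : ℕ) {t : ℤ} (ht : t ≤ T) :
    Integrable (fun ω => |noiseSum f w (fun s => e s ω) t|) μ ∧
      ∫ ω, |noiseSum f w (fun s => e s ω) t| ∂μ ≤ Real.sqrt (fNormSq σ f w) := by
  have hS : Finset.Icc (max (t - w) 1) t ⊆ Finset.Icc (1 : ℤ) T := fun s hs => by
    rw [Finset.mem_Icc] at hs ⊢
    omega
  have hi1 : Integrable (fun ω => |noiseSum f w (fun s => e s ω) t|) μ := by
    refine (integrable_finsetSum _ fun s hs => Integrable.const_mul ?_ _).abs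
    refine Integrable.of_bound (hm s (hS hs)).aestronglyMeasurable ε ?_
    filter_upwards [hbdd s (hS hs)] with ω hω using hω
  refine ⟨hi1, ?_⟩
  have hi := integrable_sq_sum_noise hm hbdd hS (fun s => f (t - s))
  have h2 := integral_sq_sum_noise hindep hm hmean hvar hbdd hS (fun s => f (t - s))
  set r := Real.sqrt (fNormSq σ f w) with hr
  have hr0 : 0 < r := Real.sqrt_pos.2 (fNormSq_pos hσ hf0 w)
  have hr2 : r ^ 2 = fNormSq σ f w := Real.sq_sqrt (fNormSq_pos hσ hf0 w).le
  -- The inequality `|x| ≤ x²/(2r) + r/2` at `r = ‖f_w‖` plays the role of `E|X| ≤ √(E X²)`.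
  have h3 : ∀ ω, |noiseSum f w (fun s => e s ω) t| ≤
      1 / (2 * r) * (∑ s ∈ Finset.Icc (max (t - w) 1) t, f (t - s) * e s ω) ^ 2 + r / 2 := by
    intro ω
    have h4 : ∀ x : ℝ, |x| ≤ 1 / (2 * r) * x ^ 2 + r / 2 := by
      intro x
      have : 1 / (2 * r) * x ^ 2 + r / 2 - |x| = (|x| - r) ^ 2 / (2 * r) := by
        rw [← sq_abs x]
        field_simp
        ring
      have h5 : 0 ≤ (|x| - r) ^ 2 / (2 * r) := by positivity
      linarith
    exact h4 _
  have h4 := integral_mono hi1 ((hi.const_mul _).add (integrable_const _)) h3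
  simp only [Pi.add_apply] at h4
  rw [integral_add (hi.const_mul _) (integrable_const _), integral_const_mul, h2] at h4
  simp only [integral_const, probReal_univ, one_smul] at h4
  have h5 := sum_sq_le_fNormSq (σ := σ) f w t
  rw [← hr2] at h5
  calc _ ≤ _ := h4
    _ ≤ 1 / (2 * r) * r ^ 2 + r / 2 := by gcongr
    _ = r := by field_simp; norm_num

/-- `3β²T/(w+1)` plus this random variable dominates `g₁`. -/
theorem integral_sum_noiseSum_le (hindep : iIndepFun (fun s : Slot T => e s) μ)
    (hm : ∀ s ∈ Finset.Icc (1 : ℤ) T, AEMeasurable (e s) μ)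
    (hmean : ∀ s ∈ Finset.Icc (1 : ℤ) T, ∫ ω, e s ω ∂μ = 0)
    (hvar : ∀ s ∈ Finset.Icc (1 : ℤ) T, ∫ ω, e s ω ^ 2 ∂μ = σ ^ 2)
    (hbdd : ∀ s ∈ Finset.Icc (1 : ℤ) T, ∀ᵐ ω ∂μ, |e s ω| ≤ ε) (hσ : 0 < σ)
    {f : ℤ → ℝ} (hf0 : f 0 = 1) (w : ℕ) {c : ℝ} (hc : 0 ≤ c) :
    ∫ ω, c * ∑ t ∈ Finset.Icc (1 : ℤ) (T - 1), |noiseSum f w (fun s => e s ω) t| ∂μ ≤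
      c * T * Real.sqrt (fNormSq σ f w) := by
  have h := fun t (ht : t ∈ Finset.Icc (1 : ℤ) (T - 1)) =>
    integral_abs_noiseSum_le hindep hm hmean hvar hbdd hσ hf0 w (t := t)
      (by rw [Finset.mem_Icc] at ht; omega)
  rw [integral_const_mul, integral_finsetSum _ fun t ht => (h t ht).1, mul_assoc]
  refine mul_le_mul_of_nonneg_left ?_ hc
  refine (Finset.sum_le_sum fun t ht => (h t ht).2).trans ?_
  rw [Finset.sum_const, nsmul_eq_mul, Int.card_Icc]
  refine mul_le_mul_of_nonneg_right ?_ (Real.sqrt_nonneg _)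
  exact_mod_cast (by omega : ((T : ℤ) - 1 + 1 - 1).toNat ≤ T)

theorem integral_g2_le (hindep : iIndepFun (fun s : Slot T => e s) μ)
    (hm : ∀ s ∈ Finset.Icc (1 : ℤ) T, AEMeasurable (e s) μ)
    (hmean : ∀ s ∈ Finset.Icc (1 : ℤ) T, ∫ ω, e s ω ∂μ = 0)
    (hvar : ∀ s ∈ Finset.Icc (1 : ℤ) T, ∫ ω, e s ω ^ 2 ∂μ = σ ^ 2)
    (hbdd : ∀ s ∈ Finset.Icc (1 : ℤ) T, ∀ᵐ ω ∂μ, |e s ω| ≤ ε) (f yhat : ℤ → ℝ) (w : ℕ) :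
    ∫ ω, g2 w T f yhat (fun s => e s ω) ∂μ ≤ V2 σ f w T := by
  have hS : ∀ τ, ∀ t ∈ windowSlots w T τ, Finset.Icc (max τ 1) t ⊆ Finset.Icc (1 : ℤ) T :=
    fun τ t ht s hs => by
      have := mem_windowSlots.1 ht
      rw [Finset.mem_Icc] at hs ⊢
      omega
  have hi : ∀ τ, ∀ t ∈ windowSlots w T τ, Integrable (fun ω =>
      (∑ s ∈ Finset.Icc (max τ 1) t, f (t - s) * e s ω) ^ 2) μ := fun τ t ht =>
    integrable_sq_sum_noise hm hbdd (hS τ t ht) fun s => f (t - s)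
  have h1 : ∀ ω, g2 w T f yhat (fun s => e s ω) = (1 / 2) * ((1 / ((w : ℝ) + 1)) *
      ∑ k ∈ Finset.range (w + 1), ∑ τ ∈ startTimes w T k, ∑ t ∈ windowSlots w T τ,
        (∑ s ∈ Finset.Icc (max τ 1) t, f (t - s) * e s ω) ^ 2) := fun ω => by
    rw [g2_eq, sum_stackedMatrix_mulVec_sq w T f fun s => e s ω]
  simp only [h1]
  rw [integral_const_mul, integral_const_mul, integral_finsetSum _ fun k _ =>
    integrable_finsetSum _ fun τ _ => integrable_finsetSum _ fun t ht => hi τ t ht]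
  have h2 : ∀ k ∈ Finset.range (w + 1), ∫ ω, ∑ τ ∈ startTimes w T k, ∑ t ∈ windowSlots w T τ,
      (∑ s ∈ Finset.Icc (max τ 1) t, f (t - s) * e s ω) ^ 2 ∂μ =
      σ ^ 2 * ∑ τ ∈ startTimes w T k, ∑ t ∈ windowSlots w T τ,
        ∑ s ∈ Finset.Icc (max τ 1) t, f (t - s) ^ 2 := by
    intro k _
    rw [integral_finsetSum _ fun τ _ => integrable_finsetSum _ fun t ht => hi τ t ht,
      Finset.mul_sum]
    refine Finset.sum_congr rfl fun τ _ => ?_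
    rw [integral_finsetSum _ fun t ht => hi τ t ht, Finset.mul_sum]
    exact Finset.sum_congr rfl fun t ht =>
      integral_sq_sum_noise hindep hm hmean hvar hbdd (hS τ t ht) fun s => f (t - s)
  rw [Finset.sum_congr rfl h2, ← Finset.mul_sum, V2, bigF_eq]
  calc _ ≤ 1 / 2 * (1 / ((w : ℝ) + 1) * (σ ^ 2 * (T * blockNormSq f w))) := by
        gcongr
        exact sum_windows_sq_le w T f
    _ = _ := by
        field_simp

/-- McDiarmid's inequality with `T` equal sensitivities: one noise value moves by at most `2ε` and
is felt with total weight `∑ |f j|`. -/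
theorem measureReal_sum_noiseSum_ge_le (hT : 1 ≤ T)
    (hindep : iIndepFun (fun s : Slot T => e s) μ)
    (hm : ∀ s ∈ Finset.Icc (1 : ℤ) T, AEMeasurable (e s) μ)
    (hmean : ∀ s ∈ Finset.Icc (1 : ℤ) T, ∫ ω, e s ω ∂μ = 0)
    (hbdd : ∀ s ∈ Finset.Icc (1 : ℤ) T, ∀ᵐ ω ∂μ, |e s ω| ≤ ε) (hσ : 0 < σ) (hε : 0 < ε)
    {f : ℤ → ℝ} (hf0 : f 0 = 1) (w : ℕ) {β : ℝ} (hβ : 0 < β) {M u : ℝ}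
    (hM : ∫ ω, β / ((w : ℝ) + 1) *
      ∑ t ∈ Finset.Icc (1 : ℤ) (T - 1), |noiseSum f w (fun s => e s ω) t| ∂μ ≤ M) (hu : 0 < u) :
    μ.real {ω | M + u ≤ β / ((w : ℝ) + 1) *
        ∑ t ∈ Finset.Icc (1 : ℤ) (T - 1), |noiseSum f w (fun s => e s ω) t|} ≤
      Real.exp (-u ^ 2 /
        (2 * ε ^ 2 * (β ^ 2 * T / (((w : ℝ) + 1) * σ ^ 2)) * fNormSq σ f w)) := by
  have hcard : Fintype.card (Slot T) = T := by
    rw [Fintype.card_coe, Int.card_Icc]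
    omega
  let q := Fintype.equivFinOfCardEq hcard
  obtain ⟨ν, hν, -, hφ⟩ := exists_compact_model hε hindep hm hmean hbdd q
  have hcs := continuousOnSlots_sum_noiseSum T f w (β / ((w : ℝ) + 1))
  obtain ⟨-, h2, h3⟩ := hφ _ hcs
  rw [h2] at hM
  rw [h3]
  set L := ∑ j ∈ Finset.range (w + 1), |f j| with hL
  refine (measureReal_pi_ge_le_exp ν (hcs.continuous_noisePath q)
    (c := fun _ => β / ((w : ℝ) + 1) * (2 * ε * L)) (fun i x r => ?_) hM hu).trans ?_
  · rw [← mul_sub, abs_mul, abs_of_nonneg (by positivity : 0 ≤ β / ((w : ℝ) + 1))]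
    refine mul_le_mul_of_nonneg_left ?_ (by positivity)
    refine abs_sum_abs_noiseSum_sub_le f w _ (s₀ := q.symm i) (fun s hs => ?_) ?_
    · unfold noisePath
      split_ifs with h
      · rw [Function.update_of_ne]
        rintro rfl
        rw [Equiv.symm_apply_apply] at hs
        exact hs rfl
      · rfl
    · rw [noisePath_of_mem, noisePath_of_mem, abs_le]
      have h4 := (x (q (q.symm i))).2
      have h5 := (Function.update x i r (q (q.symm i))).2
      rw [Set.mem_Icc] at h4 h5
      constructor <;> linarith
  · rw [Real.exp_le_exp, Finset.sum_const, Finset.card_univ, Fintype.card_fin, nsmul_eq_mul]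
    have hL1 : 1 ≤ L := by
      have h : |f ((0 : ℕ) : ℤ)| ≤ L :=
        Finset.single_le_sum (f := fun s : ℕ => |f s|) (fun _ _ => abs_nonneg _)
          (Finset.mem_range.2 (Nat.succ_pos w))
      rwa [Nat.cast_zero, hf0, abs_one] at h
    -- Cauchy–Schwarz trades the squared `ℓ¹` norm for `w + 1` times the `ℓ²` sum, cancelling one of
    -- the two factors `w + 1` in the denominator.
    have hL2 : L ^ 2 ≤ ((w : ℝ) + 1) * ∑ s ∈ Finset.range (w + 1), f s ^ 2 := by
      have := sq_sum_le_card_mul_sum_sq (s := Finset.range (w + 1)) (f := fun j : ℕ => |f j|)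
      simpa using this
    have hT0 : (0 : ℝ) < T := by exact_mod_cast hT
    have hf := fNormSq_pos hσ hf0 w
    set S := ∑ s ∈ Finset.range (w + 1), f s ^ 2 with hS
    have e1 : fNormSq σ f w = σ ^ 2 * S := rfl
    have e2 : 2 * ε ^ 2 * (β ^ 2 * T / (((w : ℝ) + 1) * σ ^ 2)) * fNormSq σ f w =
        2 * ε ^ 2 * β ^ 2 * T * S / ((w : ℝ) + 1) := by
      rw [e1]
      field_simp
    have e3 : -(2 * u ^ 2) / (T * (β / ((w : ℝ) + 1) * (2 * ε * L)) ^ 2) =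
        -u ^ 2 / (2 * ε ^ 2 * β ^ 2 * T * L ^ 2 / ((w : ℝ) + 1) ^ 2) := by
      field_simp
    rw [e2, e3, neg_div, neg_div, neg_le_neg_iff]
    have hle : 2 * ε ^ 2 * β ^ 2 * T * L ^ 2 / ((w : ℝ) + 1) ^ 2 ≤
        2 * ε ^ 2 * β ^ 2 * T * S / ((w : ℝ) + 1) := by
      calc _ ≤ 2 * ε ^ 2 * β ^ 2 * T * (((w : ℝ) + 1) * S) / ((w : ℝ) + 1) ^ 2 := by gcongr
        _ = _ := by field_simp
    gcongr

open Matrix in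
theorem measureReal_g2_ge_le (hT : 1 ≤ T)
    (hindep : iIndepFun (fun s : Slot T => e s) μ)
    (hm : ∀ s ∈ Finset.Icc (1 : ℤ) T, AEMeasurable (e s) μ)
    (hmean : ∀ s ∈ Finset.Icc (1 : ℤ) T, ∫ ω, e s ω ∂μ = 0)
    (hbdd : ∀ s ∈ Finset.Icc (1 : ℤ) T, ∀ᵐ ω ∂μ, |e s ω| ≤ ε) (hε : 0 < ε)
    {f : ℤ → ℝ} (hf0 : f 0 = 1) (yhat : ℤ → ℝ) (w : ℕ) {M u : ℝ}
    (hM : ∫ ω, g2 w T f yhat (fun s => e s ω) ∂μ ≤ M) (hM0 : 0 < M) (hu : 0 < u) :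
    μ.real {ω | M + u ≤ g2 w T f yhat (fun s => e s ω)} ≤
      Real.exp (-u ^ 2 / (2 * (4 * ε ^ 2 * topEigenvalue w T f) * (2 * M + u))) := by
  let q := Fintype.equivFin (Slot T)
  obtain ⟨ν, hν, hν0, hφ⟩ := exists_compact_model hε hindep hm hmean hbdd q
  obtain ⟨-, h2, h3⟩ := hφ _ (continuousOnSlots_g2 w T f yhat)
  rw [h2] at hM
  rw [h3]
  set A := stackedMatrix w T f with hA
  have h4 : ∀ x : Fin _ → Set.Icc (-ε) ε, g2 w T f yhat (noisePath q x) =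
      (1 / 2) * ∑ k, (A.submatrix id q.symm *ᵥ fun i => (x i : ℝ)) k ^ 2 := by
    intro x
    rw [g2_eq, Matrix.submatrix_mulVec_equiv]
    simp only [noisePath_of_mem]
    rfl
  simp only [h4] at hM ⊢
  refine measureReal_pi_quadratic_ge_le_exp (A.submatrix id q.symm)
    (topEigenvalue_pos w hT hf0) (fun v => ?_) ν continuous_subtype_val hε
    (fun a => abs_le.2 a.2) hν0 hM hM0 hu
  -- Relabelling the columns of `A` only permutes the coordinates of `Aᵀ v`.
  refine le_trans (le_of_eq ?_) (sum_transpose_mulVec_sq_le A v)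
  exact Equiv.sum_comp q.symm fun j => (Aᵀ *ᵥ v) j ^ 2

end Noise

end OnlineLasso

/-! ### Assembly of the theorem. -/

theorem mainTheorem5 {Ω : Type*} [MeasurableSpace Ω] (μ : Measure Ω) [IsProbabilityMeasure μ]
    (T w : ℕ) (hT : 1 ≤ T) (β σ ε : ℝ) (hβ : 0 < β) (hσ : 0 < σ)
    (f : ℤ → ℝ) (hf0 : f 0 = 1) (hfneg : ∀ t < 0, f t = 0)
    (yhat : ℤ → ℝ)
    (e : ℤ → Ω → ℝ)
    (hindep : iIndepFun (fun s : OnlineLasso.Slot T => e s) μ)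
    (hident : ∀ s ∈ Finset.Icc (1 : ℤ) T, IdentDistrib (e s) (e 1) μ μ)
    (hmean : ∀ s ∈ Finset.Icc (1 : ℤ) T, ∫ ω, e s ω ∂μ = 0)
    (hvar : ∀ s ∈ Finset.Icc (1 : ℤ) T, ∫ ω, e s ω ^ 2 ∂μ = σ ^ 2)
    (hbdd : ∀ s ∈ Finset.Icc (1 : ℤ) T, ∀ᵐ ω ∂μ, |e s ω| ≤ ε) :
    let D : Ω → ℝ := fun ω => OnlineLasso.competitiveDifference β w T f yhat (fun s => e s ω)
    let G1 : Ω → ℝ := fun ω => OnlineLasso.g1 β w T f yhat (fun s => e s ω)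
    let G2 : Ω → ℝ := fun ω => OnlineLasso.g2 w T f yhat (fun s => e s ω)
    let A := OnlineLasso.stackedMatrix w T f
    let lam : ℝ := OnlineLasso.topEigenvalue w T f
    let fw2 : ℝ := OnlineLasso.fNormSq σ f w
    let F : ℝ := OnlineLasso.bigF σ f w
    let V1 : ℝ := OnlineLasso.V1 β σ f w T
    let V2 : ℝ := OnlineLasso.V2 σ f w T
    let a : ℝ := 8 * ε ^ 2 * T / ((w : ℝ) + 1) * max (β ^ 2 * fw2 / σ ^ 2) (4 * lam * F)
    let b : ℝ := 16 * ε ^ 2 * lam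
    -- the two penalty terms and the quadratic form of the second one
    (∀ ω, D ω ≤ G1 ω + G2 ω) ∧
    (∀ ω, G2 ω = (1 / 2) * ∑ i, (A.mulVec (fun s => e s ω)) i ^ 2) ∧
    lam ≤ F / σ ^ 2 ∧
    -- `V1`, `V2`, `V1 + V2` bound the means
    (Integrable G1 μ ∧ ∫ ω, G1 ω ∂μ ≤ V1) ∧
    (Integrable G2 μ ∧ ∫ ω, G2 ω ∂μ ≤ V2) ∧
    (Integrable D μ ∧ ∫ ω, D ω ∂μ ≤ V1 + V2) ∧
    -- tail bounds
    (∀ u : ℝ, 0 < u →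
      μ.real {ω | G1 ω > V1 + u} ≤
        Real.exp (-u ^ 2 / (2 * ε ^ 2 * (β ^ 2 * T / (((w : ℝ) + 1) * σ ^ 2)) * fw2)) ∧
      μ.real {ω | G2 ω > V2 + u} ≤
        Real.exp (-u ^ 2 / (8 * ε ^ 2 * lam * (T / ((w : ℝ) + 1) * F + u))) ∧
      μ.real {ω | D ω > V1 + V2 + u} ≤
        Real.exp (-u ^ 2 / (8 * ε ^ 2 * (β ^ 2 * T / (((w : ℝ) + 1) * σ ^ 2)) * fw2)) +
          Real.exp (-u ^ 2 / (16 * ε ^ 2 * lam * (2 * T / ((w : ℝ) + 1) * F + u))) ∧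
      Real.exp (-u ^ 2 / (8 * ε ^ 2 * (β ^ 2 * T / (((w : ℝ) + 1) * σ ^ 2)) * fw2)) +
          Real.exp (-u ^ 2 / (16 * ε ^ 2 * lam * (2 * T / ((w : ℝ) + 1) * F + u))) ≤
        2 * Real.exp (-u ^ 2 / (a + b * u))) := by
  intro D G1 G2 A lam fw2 F V1 V2 a b
  have hm : ∀ s ∈ Finset.Icc (1 : ℤ) T, AEMeasurable (e s) μ :=
    fun s hs => (hident s hs).aemeasurable_fst
  have hε : 0 < ε := OnlineLasso.bound_pos hT hσ hvar hbdd
  have hw : (0 : ℝ) < (w : ℝ) + 1 := by positivity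
  have hT0 : (0 : ℝ) < T := by exact_mod_cast hT
  have hlam : 0 < lam := OnlineLasso.topEigenvalue_pos w hT hf0
  have hF : 0 < F := OnlineLasso.bigF_pos hσ hf0 w
  have hfw : 0 < fw2 := OnlineLasso.fNormSq_pos hσ hf0 w
  have hD : ∀ ω, D ω ≤ G1 ω + G2 ω := fun ω =>
    OnlineLasso.competitiveDifference_le hβ.le w T f yhat _
  have hcard : Fintype.card (OnlineLasso.Slot T) = T := by
    rw [Fintype.card_coe, Int.card_Icc]
    omega
  obtain ⟨ν, hν, -, hmodel⟩ := OnlineLasso.exists_compact_model hε hindep hm hmean hbdd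
    (Fintype.equivFinOfCardEq hcard)
  have iG1 : Integrable G1 μ := (hmodel _ (OnlineLasso.continuousOnSlots_g1 hβ.le w T f yhat)).1
  have iG2 : Integrable G2 μ := (hmodel _ (OnlineLasso.continuousOnSlots_g2 w T f yhat)).1
  have iD : Integrable D μ :=
    (hmodel _ (OnlineLasso.continuousOnSlots_competitiveDifference hβ.le w T f yhat)).1
  set N : Ω → ℝ := fun ω => β / ((w : ℝ) + 1) *
    ∑ t ∈ Finset.Icc (1 : ℤ) (T - 1), |OnlineLasso.noiseSum f w (fun s => e s ω) t| with hN
  have iN : Integrable N μ :=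
    (hmodel _ (OnlineLasso.continuousOnSlots_sum_noiseSum T f w (β / ((w : ℝ) + 1)))).1
  have hGN : ∀ ω, G1 ω ≤ 3 * β ^ 2 * T / ((w : ℝ) + 1) + N ω := fun ω =>
    OnlineLasso.g1_le hβ.le w f yhat _
  set M : ℝ := β * T / ((w : ℝ) + 1) * Real.sqrt fw2 with hM
  have hV1 : V1 = 3 * β ^ 2 * T / ((w : ℝ) + 1) + M := rfl
  have eN : ∫ ω, N ω ∂μ ≤ M := by
    refine (OnlineLasso.integral_sum_noiseSum_le hindep hm hmean hvar hbdd hσ hf0 w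
      (by positivity)).trans (le_of_eq ?_)
    rw [hM]
    ring
  have eG1 : ∫ ω, G1 ω ∂μ ≤ V1 := by
    have h := integral_mono iG1 ((integrable_const _).add iN) hGN
    simp only [Pi.add_apply] at h
    rw [integral_add (integrable_const _) iN] at h
    simp only [integral_const, probReal_univ, one_smul] at h
    linarith
  have eG2 : ∫ ω, G2 ω ∂μ ≤ V2 :=
    OnlineLasso.integral_g2_le hindep hm hmean hvar hbdd f yhat w
  have eD : ∫ ω, D ω ∂μ ≤ V1 + V2 := by
    have h := integral_mono iD (iG1.add iG2) hD
    simp only [Pi.add_apply] at h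
    rw [integral_add iG1 iG2] at h
    linarith
  have hV2 : V2 = T / (2 * ((w : ℝ) + 1)) * F := rfl
  have hV20 : 0 < V2 := by rw [hV2]; positivity
  have t1 : ∀ u : ℝ, 0 < u → μ.real {ω | G1 ω > V1 + u} ≤
      Real.exp (-u ^ 2 / (2 * ε ^ 2 * (β ^ 2 * T / (((w : ℝ) + 1) * σ ^ 2)) * fw2)) := by
    intro u hu
    refine le_trans (measureReal_mono fun ω hω => ?_) (OnlineLasso.measureReal_sum_noiseSum_ge_le
      hT hindep hm hmean hbdd hσ hε hf0 w hβ eN hu)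
    have h1 : V1 + u < G1 ω := hω
    have h2 := hGN ω
    -- The deterministic part `3β²T/(w+1)` of `V1` cancels, so the tail is that of the prediction
    -- errors `N`.
    have : M + u ≤ N ω := by linarith
    exact this
  have t2 : ∀ u : ℝ, 0 < u → μ.real {ω | G2 ω > V2 + u} ≤
      Real.exp (-u ^ 2 / (8 * ε ^ 2 * lam * (T / ((w : ℝ) + 1) * F + u))) := by
    intro u hu
    refine le_trans (measureReal_mono fun ω hω => ?_) ((OnlineLasso.measureReal_g2_ge_le
      hT hindep hm hmean hbdd hε hf0 yhat w eG2 hV20 hu).trans (le_of_eq ?_))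
    · have h1 : V2 + u < G2 ω := hω
      exact h1.le
    · have h1 : 2 * V2 = T / ((w : ℝ) + 1) * F := by
        rw [hV2]
        field_simp
      rw [h1]
      congr 2
      ring
  refine ⟨hD, fun ω => OnlineLasso.g2_eq w T f yhat _, ?_, ⟨iG1, eG1⟩, ⟨iG2, eG2⟩, ⟨iD, eD⟩,
    fun u hu => ⟨t1 u hu, t2 u hu, ?_, ?_⟩⟩
  · rw [le_div_iff₀ (by positivity), mul_comm]
    exact mul_le_mul_of_nonneg_left (OnlineLasso.topEigenvalue_le w T f) (by positivity)
  · have h1 := t1 (u / 2) (by positivity)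
    have h2 := t2 (u / 2) (by positivity)
    have h3 : μ.real {ω | D ω > V1 + V2 + u} ≤
        μ.real {ω | G1 ω > V1 + u / 2} + μ.real {ω | G2 ω > V2 + u / 2} := by
      refine le_trans (measureReal_mono fun ω hω => ?_) (measureReal_union_le _ _)
      by_contra hc
      rw [Set.mem_union, not_or] at hc
      have h4 : G1 ω ≤ V1 + u / 2 := not_lt.1 hc.1
      have h5 : G2 ω ≤ V2 + u / 2 := not_lt.1 hc.2
      have h6 : V1 + V2 + u < D ω := hω
      have h7 := hD ω
      linarith
    refine h3.trans (add_le_add (h1.trans (le_of_eq ?_)) (h2.trans (le_of_eq ?_)))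
    · congr 1
      field_simp
      norm_num
    · congr 1
      field_simp
      ring
  -- Both denominators are at most `a + b * u`: the first by the left entry of the maximum, the
  -- second because its constant part is the right entry and its linear part is `b * u`.
  · have key : ∀ d : ℝ, 0 < d → d ≤ a + b * u →
        Real.exp (-u ^ 2 / d) ≤ Real.exp (-u ^ 2 / (a + b * u)) := by
      intro d hd hda
      rw [Real.exp_le_exp, neg_div, neg_div, neg_le_neg_iff]
      gcongr
    have hbu : 0 ≤ b * u := by positivity
    have hc : 0 ≤ 8 * ε ^ 2 * T / ((w : ℝ) + 1) := by positivity
    have h1 := key (8 * ε ^ 2 * (β ^ 2 * T / (((w : ℝ) + 1) * σ ^ 2)) * fw2) (by positivity) (by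
      have h2 : 8 * ε ^ 2 * (β ^ 2 * T / (((w : ℝ) + 1) * σ ^ 2)) * fw2 =
          8 * ε ^ 2 * T / ((w : ℝ) + 1) * (β ^ 2 * fw2 / σ ^ 2) := by
        field_simp
      have h3 := mul_le_mul_of_nonneg_left (le_max_left (β ^ 2 * fw2 / σ ^ 2) (4 * lam * F)) hc
      linarith)
    have h2 := key (16 * ε ^ 2 * lam * (2 * T / ((w : ℝ) + 1) * F + u)) (by positivity) (by
      have h2 : 16 * ε ^ 2 * lam * (2 * T / ((w : ℝ) + 1) * F + u) =
          8 * ε ^ 2 * T / ((w : ℝ) + 1) * (4 * lam * F) + b * u := by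
        simp only [b]
        field_simp
        ring
      have h3 := mul_le_mul_of_nonneg_left (le_max_right (β ^ 2 * fw2 / σ ^ 2) (4 * lam * F)) hc
      linarith)
    linarith
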